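/- Let $\mathcal I\subseteq\mathbb R$ be an interval with more than one point, let $m\in\mathbb N_0$, and let $E,F:\mathcal I\to\mathbb R^{m\times m}$ be smooth ($C^\infty$) matrix functions. *Equivalence.* $\{E,F\}\sim\{\bar E,\bar F\}$ means that there are pointwise nonsingular smooth $L,K:\mathcal I\to\mathbb R^{m\times m}$ with $\bar E=LEK$ and $\bar F=LFK+LEK'$ on $\mathcal I$. *Regularity.* Put $S(t)=\{z\in\mathbb R^m: F(t)z\in\operatorname{im}E(t)\}$. The pair $\{E,F\}$ is pre-regular if $\operatorname{im}[E(t)\ F(t)]=\mathbb R^m$ for all $t\in\mathcal I$ and if $r=\operatorname{rank}E(t)$ and $\theta=\dim(\ker E(t)\cap S(t))$ do not depend on $t$. The pair $\{E,F\}$ is regular with index $0$ if $E$ is pointwise nonsingular, and regular with index $\mu+1$ if it is pre-regular with $r<m$ and, for some smooth $Y,C:\mathcal I\to\mathbb R^{m\times r}$ whose columns form at each $t$ bases of $\operatorname{im}E(t)$ and of $S(t)$, respectively, the reduced pair $\{Y^TEC,\;Y^TFC+Y^TEC'\}$ of $r\times r$ matrix functions is regular with index $\mu$. The pair $\{E,F\}$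 is regular if it is regular with some index $\mu\ge 0$. *Elementary nilpotent matrices.* For $\mu\ge 0$ and positive integers $\ell_1,\dots,\ell_\mu$ with sum $a$, consider the constant matrices $N\in\mathbb R^{a\times a}$ with blocks $N_{i,j}\in\mathbb R^{\ell_i\times\ell_j}$ such that $N_{i,j}=0$ for $j\neq i+1$. If $\ell_1\ge\dots\ge\ell_\mu$, let $N^{(E_c)}$ be the one with $N_{i,i+1}=\begin{bmatrix}I_{\ell_{i+1}}\\0\end{bmatrix}$; if $\ell_1\le\dots\le\ell_\mu$, let $N^{(E_r)}$ be the one with $N_{i,i+1}=\begin{bmatrix}I_{\ell_i}&0\end{bmatrix}$. **Proposition.** For every $\alpha\in\mathbb R$, the pair $\{E,F\}$ is regular if and only if $$\{E,F\}\ \sim\ \left\{\begin{bmatrix}I_d&0\\0&N^{(E_c)}\end{bmatrix},\begin{bmatrix}\alpha I_d&0\\0&I_a\end{bmatrix}\right\}$$ for some $d,a\ge 0$ with $d+a=m$ and some decreasing block sizes $\ell_1\ge\dots\ge\ell_\mu>0$ with sum $a$; and likewise $\{E,F\}$ is regular if and only if $$\{E,F\}\ \sim\ \left\{\begin{bmatrix}I_d&0\\0&N^{(E_r)}\end{bmatrix},\begin{bmatrix}\alpha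 I_d&0\\0&I_a\end{bmatrix}\right\}$$ for some $d,a\ge 0$ with $d+a=m$ and some increasing block sizes $0<\ell_1\le\dots\le\ell_\mu$ with sum $a$. -/

import Mathlib

open scoped ContDiff Matrix

/-- Matrix functions of a real variable; only their values on the interval under consideration
matter. -/
abbrev MatFun (m n : ℕ) : Type := ℝ → Matrix (Fin m) (Fin n) ℝ

/-- `A` is smooth (infinitely often differentiable, one-sidedly at end points that belong to `I`)
on the interval `I`. -/
def MatFun.SmoothOn {m n : ℕ} (I : Set ℝ) (A : MatFun m n) : Prop :=
  ∀ i j, ContDiffOn ℝ ∞ (fun t => A t i j) I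

/-- The entrywise derivative `A'` on the interval `I`. -/
noncomputable def MatFun.derivOn {m n : ℕ} (I : Set ℝ) (A : MatFun m n) : MatFun m n :=
  fun t => Matrix.of fun i j => derivWithin (fun s => A s i j) I t

/-- Equivalence `{E, F} ∼ {E', F'}` of pairs of matrix functions on `I`: there are pointwise
nonsingular smooth `L`, `K` such that `E' = L E K` and `F' = L F K + L E (dK/dt)` on `I`. -/
def PairEquiv {m : ℕ} (I : Set ℝ) (E F E' F' : MatFun m m) : Prop :=
  ∃ L K : MatFun m m,
    L.SmoothOn I ∧ K.SmoothOn I ∧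
    (∀ t ∈ I, IsUnit (L t)) ∧ (∀ t ∈ I, IsUnit (K t)) ∧
    (∀ t ∈ I, E' t = L t * E t * K t) ∧
    (∀ t ∈ I, F' t = L t * F t * K t + L t * E t * MatFun.derivOn I K t)

/-- The image of a matrix. -/
noncomputable def matIm {m n : ℕ} (A : Matrix (Fin m) (Fin n) ℝ) : Submodule ℝ (Fin m → ℝ) :=
  LinearMap.range A.mulVecLin

/-- The kernel of a matrix. -/
noncomputable def matKer {m n : ℕ} (A : Matrix (Fin m) (Fin n) ℝ) : Submodule ℝ (Fin n → ℝ) :=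
  LinearMap.ker A.mulVecLin

/-- The subspace `S = {z | F z ∈ im E}`. -/
noncomputable def constraintSpace {m : ℕ} (E F : Matrix (Fin m) (Fin m) ℝ) :
    Submodule ℝ (Fin m → ℝ) :=
  (matIm E).comap F.mulVecLin

/-- The pair `{E, F}` is pre-regular on `I` with characteristics `r` and `θ`:
`im [E F] = ℝ ^ m`, `rank E = r` and `dim (ker E ∩ S) = θ` at all points of `I`. -/
structure IsPreRegular {m : ℕ} (I : Set ℝ) (E F : MatFun m m) (r θ : ℕ) : Prop where
  im_sup_im : ∀ t ∈ I, matIm (E t) ⊔ matIm (F t) = ⊤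
  rank_eq : ∀ t ∈ I, (E t).rank = r
  finrank_inf : ∀ t ∈ I,
    Module.finrank ℝ ↥(matKer (E t) ⊓ constraintSpace (E t) (F t)) = θ

/-- The columns of the smooth matrix function `B` form, at each point `t` of `I`, a basis of the
subspace `W t`. -/
structure IsSmoothBasis {m r : ℕ} (I : Set ℝ) (B : MatFun m r)
    (W : ℝ → Submodule ℝ (Fin m → ℝ)) : Prop where
  smooth : B.SmoothOn I
  ker_eq : ∀ t ∈ I, matKer (B t) = ⊥
  im_eq : ∀ t ∈ I, matIm (B t) = W t

/-- The pair `{E, F}` is regular on `I` with index `μ`.  Index `0` means that `E` is pointwise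
nonsingular.  Index `μ + 1` means that `{E, F}` is pre-regular with `rank E = r < m`, and that, for some
smooth bases `Y` of `im E` and `C` of `S`, the reduced pair
`{Yᵀ E C, Yᵀ F C + Yᵀ E C'}` of size `r`, which describes the flow of the equation inside `S`,
is regular with index `μ`. (Other bases lead to an equivalent reduced pair.) -/
def IsRegularOfIndex (I : Set ℝ) : ℕ → ∀ {m : ℕ}, MatFun m m → MatFun m m → Prop
  | 0, _, E, _ => ∀ t ∈ I, IsUnit (E t)
  | μ + 1, m, E, F =>
      ∃ r θ : ℕ, r < m ∧ IsPreRegular I E F r θ ∧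
        ∃ Y C : MatFun m r,
          IsSmoothBasis I Y (fun t => matIm (E t)) ∧
          IsSmoothBasis I C (fun t => constraintSpace (E t) (F t)) ∧
          IsRegularOfIndex I μ
            (fun t => (Y t)ᵀ * E t * C t)
            (fun t => (Y t)ᵀ * F t * C t + (Y t)ᵀ * E t * MatFun.derivOn I C t)

/-- The pair `{E, F}` is regular on `I` (with some index). -/
def IsRegularPair {m : ℕ} (I : Set ℝ) (E F : MatFun m m) : Prop :=
  ∃ μ : ℕ, IsRegularOfIndex I μ E F

/-- The elementary block matrix with block sizes `ℓ₁, …, ℓ_μ`: the `(x, y)` entry of the block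
`(i, i + 1)`, of format `ℓ_i × ℓ_{i+1}`, is `1` if `x = y` and `0` otherwise; all other blocks
vanish.  For decreasing block sizes the block `(i, i + 1)` is `[I; 0]` (identity of size `ℓ_{i+1}`
on top of zeros) and the matrix is `N^(E_c)`; for increasing block sizes the block is `[I 0]`
(identity of size `ℓ_i`, then zeros) and the matrix is `N^(E_r)`. -/
def elemNilpotent {μ : ℕ} (ℓ : Fin μ → ℕ) :
    Matrix (Σ i : Fin μ, Fin (ℓ i)) (Σ i : Fin μ, Fin (ℓ i)) ℝ :=
  Matrix.of fun p q => if (p.1 : ℕ) + 1 = (q.1 : ℕ) ∧ (p.2 : ℕ) = (q.2 : ℕ) then 1 else 0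

/-- The order-preserving numbering of the rows (columns) of a matrix of size `m = d + ∑ ℓ_i`:
first the `d` rows of the leading block, then the blocks of sizes `ℓ₁, …, ℓ_μ`. -/
def blockIndex {m d μ : ℕ} {ℓ : Fin μ → ℕ} (h : d + ∑ i, ℓ i = m) :
    (Fin d ⊕ (Σ i : Fin μ, Fin (ℓ i))) ≃ Fin m :=
  ((Equiv.sumCongr (Equiv.refl (Fin d)) finSigmaFinEquiv).trans finSumFinEquiv).trans (finCongr h)

/-- The block diagonal matrix `diag(A, B)` with `A` of size `d` and `B` of size `∑ ℓ_i`. -/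
def blockDiag₂ {m d μ : ℕ} {ℓ : Fin μ → ℕ} (h : d + ∑ i, ℓ i = m)
    (A : Matrix (Fin d) (Fin d) ℝ)
    (B : Matrix (Σ i : Fin μ, Fin (ℓ i)) (Σ i : Fin μ, Fin (ℓ i)) ℝ) :
    Matrix (Fin m) (Fin m) ℝ :=
  Matrix.reindex (blockIndex h) (blockIndex h) (Matrix.fromBlocks A 0 0 B)

/-- `{E, F} ∼ {diag(I_d, N), diag(α I_d, I_a)}` on `I`, where `N` is the elementary matrix with
positive block sizes `ℓ₁, …, ℓ_μ` that satisfy `P` (increasing or decreasing). -/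
def EquivToElementary {m : ℕ} (I : Set ℝ) (E F : MatFun m m) (α : ℝ)
    (P : ∀ {μ : ℕ}, (Fin μ → ℕ) → Prop) : Prop :=
  ∃ (d μ : ℕ) (ℓ : Fin μ → ℕ) (h : d + ∑ i, ℓ i = m),
    (∀ i, 0 < ℓ i) ∧ P ℓ ∧
    PairEquiv I E F
      (fun _ => blockDiag₂ h 1 (elemNilpotent ℓ))
      (fun _ => blockDiag₂ h (α • 1) 1)

/-- Equivalence to `{diag(I_d, N), diag(α I_d, I_a)}` with `N = N^(E_c)`, the elementary matrix with
decreasing block sizes. -/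
def EquivToElementaryC {m : ℕ} (I : Set ℝ) (E F : MatFun m m) (α : ℝ) : Prop :=
  EquivToElementary I E F α (fun ℓ => Antitone ℓ)

/-- Equivalence to `{diag(I_d, N), diag(α I_d, I_a)}` with `N = N^(E_r)`, the elementary matrix with
increasing block sizes. -/
def EquivToElementaryR {m : ℕ} (I : Set ℝ) (E F : MatFun m m) (α : ℝ) : Prop :=
  EquivToElementary I E F α (fun ℓ => Monotone ℓ)

/-! Regular implies elementary, by induction on the index. For index 0, the solution K of dK/dt = (α
- E⁻¹F)K and L = K⁻¹E⁻¹ turn the pair into {I, αI}. For index μ + 1, the bases Y and C are completed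
to smooth nonsingular matrices [Y Z] and [C D]. Since E and FC + E dC/dt map into im E, these
transform the pair into {[Ẽ B; 0 0], [F̃ G₁; 0 G₂]}, where {Ẽ, F̃} is the reduced pair. The
condition im [E F] = ℝ^m makes G₂ nonsingular, and row operations turn [G₁; G₂] into [0; I]
(`exists_bordered_form`). By induction Ẽ becomes diag(I, N) with increasing block sizes. As [Ẽ B]
has full row rank and the last block row of N vanishes, B has full row rank there and can be
normalized to [I 0]; its other rows are cleared by the columns of diag(I, N). What remains is an
elementary pair with one more block, of size m - r (`exists_elementary_of_bordered`). The matrices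
N^(E_r) and N^(E_c) with reversed block sizes differ by a permutation (`exists_reverse_equiv`).

Elementary implies regular: regularity is invariant under equivalence
(`IsRegularOfIndex.of_pairEquivGen`), and an exponential factor moves α to 1. This leaves a constant
pair {M, I}, for which a reduction step replaces M by its restriction to im M
(`isRegularPair_const`).

The analytic inputs are smooth fundamental matrices on an arbitrary interval
(`exists_smooth_fundamentalMatrix`) and the completion of smooth bases (`exists_completion`). -/

/-! ### Calculus of smooth matrix functions and the equivalence relation on pairs. -/

section SmoothMatrices

variable {ι κ l p : Type*}

/-- Entrywise smoothness on `I` of a matrix function with arbitrary index types. -/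
def SmoothMat (I : Set ℝ) (A : ℝ → Matrix ι κ ℝ) : Prop :=
  ∀ i j, ContDiffOn ℝ ∞ (fun t => A t i j) I

/-- The entrywise derivative on `I` of a matrix function with arbitrary index types. -/
noncomputable def dMat (I : Set ℝ) (A : ℝ → Matrix ι κ ℝ) : ℝ → Matrix ι κ ℝ :=
  fun t => Matrix.of fun i j => derivWithin (fun s => A s i j) I t

lemma interval_uniqueDiffOn {I : Set ℝ} (hI : I.OrdConnected) (hI' : I.Nontrivial) :
    UniqueDiffOn ℝ I := by
  apply uniqueDiffOn_convex hI.convex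
  obtain ⟨x, hx, y, hy, hxy⟩ := hI'.exists_lt
  have h : Set.Ioo x y ⊆ interior I :=
    interior_maximal (Set.Ioo_subset_Icc_self.trans (hI.out hx hy)) isOpen_Ioo
  exact (Set.nonempty_Ioo.2 hxy).mono h

namespace SmoothMat

variable {I : Set ℝ}

lemma const (M : Matrix ι κ ℝ) : SmoothMat I (fun _ => M) := fun _ _ => contDiffOn_const

lemma add {A B : ℝ → Matrix ι κ ℝ} (hA : SmoothMat I A) (hB : SmoothMat I B) :
    SmoothMat I (fun t => A t + B t) := fun i j => (hA i j).add (hB i j)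

lemma sub {A B : ℝ → Matrix ι κ ℝ} (hA : SmoothMat I A) (hB : SmoothMat I B) :
    SmoothMat I (fun t => A t - B t) := fun i j => (hA i j).sub (hB i j)

lemma neg {A : ℝ → Matrix ι κ ℝ} (hA : SmoothMat I A) :
    SmoothMat I (fun t => -A t) := fun i j => (hA i j).neg

lemma mul [Fintype κ] {A : ℝ → Matrix ι κ ℝ} {B : ℝ → Matrix κ l ℝ} (hA : SmoothMat I A)
    (hB : SmoothMat I B) : SmoothMat I (fun t => A t * B t) := fun i j => by
  simp only [Matrix.mul_apply]
  exact ContDiffOn.sum fun k _ => (hA i k).mul (hB k j)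

lemma transpose {A : ℝ → Matrix ι κ ℝ} (hA : SmoothMat I A) :
    SmoothMat I (fun t => (A t)ᵀ) := fun i j => hA j i

lemma submatrix {A : ℝ → Matrix ι κ ℝ} (hA : SmoothMat I A) (f : l → ι) (g : p → κ) :
    SmoothMat I (fun t => (A t).submatrix f g) := fun i j => hA (f i) (g j)

lemma fromBlocks {A : ℝ → Matrix ι κ ℝ} {B : ℝ → Matrix ι p ℝ} {C : ℝ → Matrix l κ ℝ}
    {D : ℝ → Matrix l p ℝ} (hA : SmoothMat I A) (hB : SmoothMat I B) (hC : SmoothMat I C)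
    (hD : SmoothMat I D) : SmoothMat I (fun t => Matrix.fromBlocks (A t) (B t) (C t) (D t)) := by
  rintro (i | i) (j | j)
  exacts [hA i j, hB i j, hC i j, hD i j]

lemma det [Fintype ι] [DecidableEq ι] {A : ℝ → Matrix ι ι ℝ} (hA : SmoothMat I A) :
    ContDiffOn ℝ ∞ (fun t => (A t).det) I := by
  simp only [Matrix.det_apply']
  exact ContDiffOn.sum fun σ _ => contDiffOn_const.mul (contDiffOn_prod fun i _ => hA _ _)

lemma adjugate [Fintype ι] [DecidableEq ι] {A : ℝ → Matrix ι ι ℝ} (hA : SmoothMat I A) :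
    SmoothMat I (fun t => (A t).adjugate) := fun i j => by
  simp only [Matrix.adjugate_apply]
  refine det (A := fun t => (A t).updateRow j (Pi.single i 1)) fun a b => ?_
  by_cases h : a = j
  · subst h; simpa using contDiffOn_const
  · simpa [Matrix.updateRow_ne h] using hA a b

lemma inv [Fintype ι] [DecidableEq ι] {A : ℝ → Matrix ι ι ℝ} (hA : SmoothMat I A)
    (hu : ∀ t ∈ I, IsUnit (A t)) : SmoothMat I (fun t => (A t)⁻¹) := fun i j => by
  simp only [Matrix.inv_def, Ring.inverse_eq_inv', Matrix.smul_apply, smul_eq_mul]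
  refine (hA.det.inv fun t ht => ?_).mul (hA.adjugate i j)
  exact ((Matrix.isUnit_iff_isUnit_det _).1 (hu t ht)).ne_zero

lemma differentiableWithinAt {A : ℝ → Matrix ι κ ℝ} (hA : SmoothMat I A) {t : ℝ} (ht : t ∈ I)
    (i : ι) (j : κ) : DifferentiableWithinAt ℝ (fun s => A s i j) I t :=
  (hA i j).differentiableOn (by simp) t ht

lemma derivative {A : ℝ → Matrix ι κ ℝ} (hA : SmoothMat I A) (hU : UniqueDiffOn ℝ I) :
    SmoothMat I (dMat I A) := fun i j => (hA i j).derivWithin hU (by simp)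

end SmoothMat

variable {I : Set ℝ}

lemma dMat_mul [Fintype κ] {A : ℝ → Matrix ι κ ℝ} {B : ℝ → Matrix κ l ℝ} (hU : UniqueDiffOn ℝ I)
    (hA : SmoothMat I A) (hB : SmoothMat I B) {t : ℝ} (ht : t ∈ I) :
    dMat I (fun t => A t * B t) t = dMat I A t * B t + A t * dMat I B t := by
  ext i j
  simp only [dMat, Matrix.mul_apply, Matrix.of_apply, Matrix.add_apply, ← Finset.sum_add_distrib]
  exact (HasDerivWithinAt.fun_sum fun k _ =>
    (hA.differentiableWithinAt ht i k).hasDerivWithinAt.mul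
      (hB.differentiableWithinAt ht k j).hasDerivWithinAt).derivWithin (hU t ht)

lemma dMat_const (M : Matrix ι κ ℝ) (t : ℝ) : dMat I (fun _ => M) t = 0 := by
  ext i j; simp [dMat]

lemma dMat_congr {A B : ℝ → Matrix ι κ ℝ} (h : ∀ t ∈ I, A t = B t) {t : ℝ} (ht : t ∈ I) :
    dMat I A t = dMat I B t := by
  ext i j
  exact derivWithin_congr (fun s hs => by rw [h s hs]) (by rw [h t ht])

lemma dMat_fromBlocks (A : ℝ → Matrix ι κ ℝ) (B : ℝ → Matrix ι p ℝ) (C : ℝ → Matrix l κ ℝ)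
    (D : ℝ → Matrix l p ℝ) (t : ℝ) :
    dMat I (fun t => Matrix.fromBlocks (A t) (B t) (C t) (D t)) t =
      Matrix.fromBlocks (dMat I A t) (dMat I B t) (dMat I C t) (dMat I D t) := by
  ext (i | i) (j | j) <;> rfl

/-- `L` and `L'` are smooth and inverse to each other on `I`. -/
structure SmoothInverse [Fintype ι] [Fintype κ] [DecidableEq ι] [DecidableEq κ] (I : Set ℝ)
    (L : ℝ → Matrix ι κ ℝ) (L' : ℝ → Matrix κ ι ℝ) : Prop where
  smooth : SmoothMat I L
  smooth' : SmoothMat I L'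
  mul_inv : ∀ t ∈ I, L t * L' t = 1
  inv_mul : ∀ t ∈ I, L' t * L t = 1

namespace SmoothInverse

variable [Fintype ι] [Fintype κ] [Fintype l] [Fintype p] [DecidableEq ι] [DecidableEq κ]
  [DecidableEq l] [DecidableEq p]

lemma symm {L : ℝ → Matrix ι κ ℝ} {L' : ℝ → Matrix κ ι ℝ} (h : SmoothInverse I L L') :
    SmoothInverse I L' L := ⟨h.smooth', h.smooth, h.inv_mul, h.mul_inv⟩

lemma one : SmoothInverse I (fun _ => (1 : Matrix ι ι ℝ)) (fun _ => 1) :=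
  ⟨.const _, .const _, fun _ _ => one_mul _, fun _ _ => one_mul _⟩

lemma mul {L : ℝ → Matrix ι κ ℝ} {L' : ℝ → Matrix κ ι ℝ} {M : ℝ → Matrix κ l ℝ}
    {M' : ℝ → Matrix l κ ℝ} (h : SmoothInverse I L L') (h' : SmoothInverse I M M') :
    SmoothInverse I (fun t => L t * M t) (fun t => M' t * L' t) where
  smooth := h.smooth.mul h'.smooth
  smooth' := h'.smooth'.mul h.smooth'
  mul_inv t ht := by
    rw [Matrix.mul_assoc, ← Matrix.mul_assoc (M t), h'.mul_inv t ht, Matrix.one_mul,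
      h.mul_inv t ht]
  inv_mul t ht := by
    rw [Matrix.mul_assoc, ← Matrix.mul_assoc (L' t), h.inv_mul t ht, Matrix.one_mul,
      h'.inv_mul t ht]

lemma of_isUnit {L : ℝ → Matrix ι ι ℝ} (hL : SmoothMat I L) (hu : ∀ t ∈ I, IsUnit (L t)) :
    SmoothInverse I L (fun t => (L t)⁻¹) where
  smooth := hL
  smooth' := hL.inv hu
  mul_inv t ht := Matrix.mul_nonsing_inv _ ((Matrix.isUnit_iff_isUnit_det _).1 (hu t ht))
  inv_mul t ht := Matrix.nonsing_inv_mul _ ((Matrix.isUnit_iff_isUnit_det _).1 (hu t ht))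

lemma isUnit {L L' : ℝ → Matrix ι ι ℝ} (h : SmoothInverse I L L') {t : ℝ} (ht : t ∈ I) :
    IsUnit (L t) :=
  ⟨⟨L t, L' t, h.mul_inv t ht, h.inv_mul t ht⟩, rfl⟩

lemma upperTriangular {P P' : ℝ → Matrix ι ι ℝ} {Q Q' : ℝ → Matrix κ κ ℝ} {X : ℝ → Matrix ι κ ℝ}
    (hP : SmoothInverse I P P') (hQ : SmoothInverse I Q Q') (hX : SmoothMat I X) :
    SmoothInverse I (fun t => Matrix.fromBlocks (P t) (X t) 0 (Q t))
      (fun t => Matrix.fromBlocks (P' t) (-(P' t * X t * Q' t)) 0 (Q' t)) where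
  smooth := hP.smooth.fromBlocks hX (.const 0) hQ.smooth
  smooth' := hP.smooth'.fromBlocks ((hP.smooth'.mul hX).mul hQ.smooth').neg (.const 0) hQ.smooth'
  mul_inv t ht := by
    simp [Matrix.fromBlocks_multiply, ← Matrix.mul_assoc, hP.mul_inv t ht, hQ.mul_inv t ht]
  inv_mul t ht := by
    simp [Matrix.fromBlocks_multiply, Matrix.mul_assoc, hP.inv_mul t ht, hQ.inv_mul t ht]

lemma diagonal {P : ℝ → Matrix ι κ ℝ} {P' : ℝ → Matrix κ ι ℝ} {Q : ℝ → Matrix l p ℝ}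
    {Q' : ℝ → Matrix p l ℝ} (hP : SmoothInverse I P P') (hQ : SmoothInverse I Q Q') :
    SmoothInverse I (fun t => Matrix.fromBlocks (P t) 0 0 (Q t))
      (fun t => Matrix.fromBlocks (P' t) 0 0 (Q' t)) where
  smooth := hP.smooth.fromBlocks (.const 0) (.const 0) hQ.smooth
  smooth' := hP.smooth'.fromBlocks (.const 0) (.const 0) hQ.smooth'
  mul_inv t ht := by
    simp [Matrix.fromBlocks_multiply, hP.mul_inv t ht, hQ.mul_inv t ht]
  inv_mul t ht := by
    simp [Matrix.fromBlocks_multiply, hP.inv_mul t ht, hQ.inv_mul t ht]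

lemma reindex (e : ι ≃ κ) : SmoothInverse I (fun _ => (1 : Matrix ι ι ℝ).submatrix id e.symm)
    (fun _ => (1 : Matrix ι ι ℝ).submatrix e.symm id) where
  smooth := .const _
  smooth' := .const _
  mul_inv t ht := by
    rw [Matrix.submatrix_mul_equiv]; simp
  inv_mul t ht := by
    rw [← Matrix.submatrix_mul _ _ _ _ _ Function.bijective_id]; simp

end SmoothInverse

variable [Fintype ι] [Fintype κ] [Fintype l] [DecidableEq ι] [DecidableEq κ] [DecidableEq l]

/-- Equivalence of pairs of square matrix functions, with possibly different index types. -/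
def PairEquivGen (I : Set ℝ) (E F : ℝ → Matrix ι ι ℝ) (E' F' : ℝ → Matrix κ κ ℝ) : Prop :=
  ∃ (L : ℝ → Matrix κ ι ℝ) (L' : ℝ → Matrix ι κ ℝ) (K : ℝ → Matrix ι κ ℝ) (K' : ℝ → Matrix κ ι ℝ),
    SmoothInverse I L L' ∧ SmoothInverse I K K' ∧
    (∀ t ∈ I, E' t = L t * E t * K t) ∧
    (∀ t ∈ I, F' t = L t * F t * K t + L t * E t * dMat I K t)

namespace PairEquivGen

lemma pairEquiv_iff {m : ℕ} {E F E' F' : MatFun m m} :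
    PairEquivGen I E F E' F' ↔ PairEquiv I E F E' F' := by
  constructor
  · rintro ⟨L, L', K, K', hL, hK, hE, hF⟩
    exact ⟨L, K, hL.smooth, hK.smooth, fun t ht => hL.isUnit ht, fun t ht => hK.isUnit ht, hE, hF⟩
  · rintro ⟨L, K, hL, hK, hLu, hKu, hE, hF⟩
    exact ⟨L, _, K, _, .of_isUnit hL hLu, .of_isUnit hK hKu, hE, hF⟩

variable {E F : ℝ → Matrix ι ι ℝ} {E' F' : ℝ → Matrix κ κ ℝ} {E'' F'' : ℝ → Matrix l l ℝ}

lemma of_eq {G H : ℝ → Matrix ι ι ℝ} (hE : ∀ t ∈ I, G t = E t) (hF : ∀ t ∈ I, H t = F t) :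
    PairEquivGen I E F G H :=
  ⟨_, _, _, _, .one, .one, fun t ht => by simp [hE t ht],
    fun t ht => by simp [hF t ht, dMat_const]⟩

lemma mul_left {L L' : ℝ → Matrix ι ι ℝ} (hL : SmoothInverse I L L') :
    PairEquivGen I E F (fun t => L t * E t) (fun t => L t * F t) :=
  ⟨_, _, _, _, hL, .one, fun t ht => by simp, fun t ht => by simp [dMat_const]⟩

lemma trans (hU : UniqueDiffOn ℝ I) (h : PairEquivGen I E F E' F')
    (h' : PairEquivGen I E' F' E'' F'') : PairEquivGen I E F E'' F'' := by
  obtain ⟨L, L', K, K', hL, hK, hE, hF⟩ := h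
  obtain ⟨M, M', H, H', hM, hH, hE', hF'⟩ := h'
  refine ⟨_, _, _, _, hM.mul hL, hK.mul hH, fun t ht => ?_, fun t ht => ?_⟩
  · rw [hE' t ht, hE t ht]; simp only [Matrix.mul_assoc]
  · rw [hF' t ht, hF t ht, hE t ht, dMat_mul hU hK.smooth hH.smooth ht]
    simp only [Matrix.mul_assoc, Matrix.mul_add, Matrix.add_mul, add_assoc]

lemma symm (hU : UniqueDiffOn ℝ I) (h : PairEquivGen I E F E' F') : PairEquivGen I E' F' E F := by
  obtain ⟨L, L', K, K', hL, hK, hE, hF⟩ := h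
  refine ⟨_, _, _, _, hL.symm, hK.symm, fun t ht => ?_, fun t ht => ?_⟩
  · rw [hE t ht]
    simp only [Matrix.mul_assoc, hK.mul_inv t ht, Matrix.mul_one]
    rw [← Matrix.mul_assoc, hL.inv_mul t ht, Matrix.one_mul]
  · have h1 := dMat_mul hU hK.smooth hK.smooth' ht
    rw [dMat_congr hK.mul_inv ht, dMat_const] at h1
    have h2 : L' t * F' t * K' t + L' t * E' t * dMat I K' t = (L' t * L t) * F t * (K t * K' t) +
        (L' t * L t) * E t * (dMat I K t * K' t + K t * dMat I K' t) := by
      rw [hF t ht, hE t ht]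
      simp only [Matrix.mul_assoc, Matrix.mul_add, Matrix.add_mul, add_assoc]
    rw [h2, ← h1, hK.mul_inv t ht, hL.inv_mul t ht]
    simp

lemma submatrix (e : ι ≃ κ) : PairEquivGen I E F (fun t => (E t).submatrix e.symm e.symm)
    (fun t => (F t).submatrix e.symm e.symm) := by
  refine ⟨_, _, _, _, (SmoothInverse.reindex e).symm, .reindex e, fun t ht => ?_, fun t ht => ?_⟩
  · ext i j; simp [Matrix.mul_apply, Matrix.one_apply]
  · rw [dMat_const]
    ext i j; simp [Matrix.mul_apply, Matrix.one_apply]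

end PairEquivGen

end SmoothMatrices

/-! ### Fundamental matrices of linear differential equations. -/

section LinearODE

open MeasureTheory Filter Topology

variable {𝔸 : Type*} [NormedRing 𝔸] [NormedAlgebra ℝ 𝔸]

/-- The terms of the Volterra series of the linear differential equation `x' = A x`. -/
noncomputable def volterraTerm (A : ℝ → 𝔸) (t₀ : ℝ) : ℕ → ℝ → 𝔸
  | 0 => fun _ => 1
  | n + 1 => fun t => ∫ s in t₀..t, A s * volterraTerm A t₀ n s

lemma continuous_volterraTerm {A : ℝ → 𝔸} (hA : Continuous A) (t₀ : ℝ) (n : ℕ) :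
    Continuous (volterraTerm A t₀ n) := by
  induction n with
  | zero => exact continuous_const
  | succ n ih =>
    exact intervalIntegral.continuous_primitive
      (fun a b => (hA.mul ih).intervalIntegrable a b) t₀

lemma hasDerivAt_volterraTerm [CompleteSpace 𝔸] {A : ℝ → 𝔸} (hA : Continuous A)
    (t₀ : ℝ) (n : ℕ) (t : ℝ) : HasDerivAt (volterraTerm A t₀ (n + 1)) (A t * volterraTerm A t₀ n t) t := by
  have h : Continuous fun s => A s * volterraTerm A t₀ n s :=
    hA.mul (continuous_volterraTerm hA t₀ n)
  exact intervalIntegral.integral_hasDerivAt_right (h.intervalIntegrable _ _)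
    (h.stronglyMeasurableAtFilter _ _) h.continuousAt

lemma norm_volterraTerm_le {A : ℝ → 𝔸} (hA : Continuous A) {M : ℝ} (hM : ∀ t, ‖A t‖ ≤ M)
    (t₀ : ℝ) (n : ℕ) (t : ℝ) :
    ‖volterraTerm A t₀ n t‖ ≤ ‖(1 : 𝔸)‖ * ((M * |t - t₀|) ^ n / n.factorial) := by
  have hM0 : 0 ≤ M := (norm_nonneg _).trans (hM 0)
  induction n generalizing t with
  | zero => simp [volterraTerm]
  | succ n ih =>
    have hc : Continuous fun s => A s * volterraTerm A t₀ n s :=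
      hA.mul (continuous_volterraTerm hA t₀ n)
    calc ‖volterraTerm A t₀ (n + 1) t‖
        ≤ ∫ s in Set.uIoc t₀ t, ‖A s * volterraTerm A t₀ n s‖ :=
          intervalIntegral.norm_integral_le_integral_norm_uIoc
      _ ≤ ∫ s in Set.uIoc t₀ t, (‖(1 : 𝔸)‖ * M ^ (n + 1) / n.factorial) * |s - t₀| ^ n := by
          refine setIntegral_mono ?_ ?_ fun s => ?_
          · exact (intervalIntegrable_iff.1 (hc.norm.intervalIntegrable _ _))
          · exact (intervalIntegrable_iff.1 (Continuous.intervalIntegrable (by fun_prop) _ _))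
          · calc ‖A s * volterraTerm A t₀ n s‖ ≤ ‖A s‖ * ‖volterraTerm A t₀ n s‖ := norm_mul_le _ _
              _ ≤ M * (‖(1 : 𝔸)‖ * ((M * |s - t₀|) ^ n / n.factorial)) := by
                gcongr
                exacts [hM s, ih s]
              _ = _ := by rw [mul_pow]; ring
      _ = ‖(1 : 𝔸)‖ * ((M * |t - t₀|) ^ (n + 1) / (n + 1).factorial) := by
          rw [integral_const_mul, integral_pow_abs_sub_uIoc, mul_pow, Nat.factorial_succ]
          push_cast
          field_simp

/-- The Volterra series is dominated by the exponential series of M|t - t₀|. So is the series of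
derivatives, uniformly on balls around t₀, and termwise differentiation gives A times the series. -/
theorem exists_hasDerivAt_linear [CompleteSpace 𝔸] {A : ℝ → 𝔸} (hA : Continuous A)
    {M : ℝ} (hM : ∀ t, ‖A t‖ ≤ M) (t₀ : ℝ) : ∃ K : ℝ → 𝔸, K t₀ = 1 ∧ ∀ t, HasDerivAt K (A t * K t) t := by
  have hM0 : 0 ≤ M := (norm_nonneg _).trans (hM 0)
  obtain ⟨u, hu0, hu, hd, hle⟩ : ∃ u : ℕ → ℝ → 𝔸, u 0 = (fun _ => 1) ∧ (∀ n, u (n + 1) t₀ = 0) ∧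
      (∀ n t, HasDerivAt (u (n + 1)) (A t * u n t) t) ∧
      ∀ n t, ‖u n t‖ ≤ ‖(1 : 𝔸)‖ * ((M * |t - t₀|) ^ n / n.factorial) :=
    ⟨volterraTerm A t₀, rfl, fun n => intervalIntegral.integral_same,
      hasDerivAt_volterraTerm hA t₀, norm_volterraTerm_le hA hM t₀⟩
  have hsum : ∀ t, Summable fun n => u n t := fun t =>
    .of_norm_bounded ((Real.summable_pow_div_factorial (M * |t - t₀|)).mul_left ‖(1 : 𝔸)‖)
      fun n => hle n t
  refine ⟨fun t => 1 + ∑' n, u (n + 1) t, by simp [hu], fun t => ?_⟩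
  have hK : 1 + ∑' n, u (n + 1) t = ∑' n, u n t := by
    rw [(hsum t).tsum_eq_zero_add, hu0]
  simp only [hK]
  rw [← (hsum t).tsum_mul_left]
  refine HasDerivAt.const_add 1 ?_
  have hMR : Summable fun n : ℕ =>
      M * (‖(1 : 𝔸)‖ * ((M * (|t - t₀| + 1)) ^ n / (n.factorial : ℝ))) :=
    ((Real.summable_pow_div_factorial _).mul_left _).mul_left _
  have hb : ∀ n, ∀ y ∈ Metric.ball t₀ (|t - t₀| + 1), ‖A y * u n y‖ ≤
      M * (‖(1 : 𝔸)‖ * ((M * (|t - t₀| + 1)) ^ n / (n.factorial : ℝ))) := fun n y hy => by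
    have hy' : |y - t₀| ≤ |t - t₀| + 1 := by rw [← Real.dist_eq]; exact (Metric.mem_ball.1 hy).le
    calc ‖A y * u n y‖ ≤ ‖A y‖ * ‖u n y‖ := norm_mul_le _ _
      _ ≤ M * (‖(1 : 𝔸)‖ * ((M * |y - t₀|) ^ n / n.factorial)) := by
        gcongr
        exacts [hM y, hle n y]
      _ ≤ _ := by gcongr
  have ht₀ : t₀ ∈ Metric.ball t₀ (|t - t₀| + 1) := Metric.mem_ball_self (by positivity)
  have ht : t ∈ Metric.ball t₀ (|t - t₀| + 1) := by
    rw [Metric.mem_ball, Real.dist_eq]; linarith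
  exact hasDerivAt_tsum_of_isPreconnected hMR Metric.isOpen_ball (convex_ball t₀ _).isPreconnected
    (fun n y _ => hd n y) hb ht₀ ((summable_nat_add_iff 1).2 (hsum t₀)) ht

section

attribute [local instance] Matrix.linftyOpNormedRing Matrix.linftyOpNormedAlgebra

/-- The coefficient is continued beyond [a, b] by its end values, which makes it bounded and
continuous on ℝ. The matrix norm only has to be submultiplicative, since the conclusion is
entrywise. -/
theorem exists_fundamentalMatrix_Icc {ι : Type*} [Fintype ι] [DecidableEq ι] {a b : ℝ}
    {A : ℝ → Matrix ι ι ℝ} (hA : ∀ i j, ContinuousOn (fun t => A t i j) (Set.Icc a b)) {t₀ : ℝ}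
    (ht₀ : t₀ ∈ Set.Icc a b) :
    ∃ K : ℝ → Matrix ι ι ℝ, K t₀ = 1 ∧ ∀ t ∈ Set.Icc a b, ∀ i j,
      HasDerivWithinAt (fun t => K t i j) ((A t * K t) i j) (Set.Icc a b) t := by
  have hab : a ≤ b := ht₀.1.trans ht₀.2
  have hA' : ContinuousOn A (Set.Icc a b) :=
    continuousOn_pi.2 fun i => continuousOn_pi.2 fun j => hA i j
  have hc : Continuous fun t => A (Set.projIcc a b hab t) :=
    hA'.comp_continuous (continuous_subtype_val.comp continuous_projIcc) fun t => Subtype.prop _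
  obtain ⟨M, hM⟩ := isCompact_Icc.exists_bound_of_continuousOn hA'
  obtain ⟨K, hK0, hK⟩ := exists_hasDerivAt_linear hc (fun t => hM _ (Subtype.prop _)) t₀
  refine ⟨K, hK0, fun t ht i j => ?_⟩
  have h := hK t
  rw [Set.projIcc_of_mem hab ht] at h
  exact ((LinearMap.toContinuousLinearMap (Matrix.entryLinearMap ℝ ℝ i j)).hasFDerivAt.comp_hasDerivAt
    t h).hasDerivWithinAt

end

open Topology in
-- Reduces local statements on an arbitrary interval to compact subintervals; if t is an end point
-- of `I`, it serves as an end point of [a, b] too.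
lemma exists_mem_Icc_mem_nhdsWithin {I : Set ℝ} {t₀ t : ℝ} (ht₀ : t₀ ∈ I) (ht : t ∈ I) :
    ∃ a ∈ I, ∃ b ∈ I, t₀ ∈ Set.Icc a b ∧ t ∈ Set.Icc a b ∧ Set.Icc a b ∈ 𝓝[I] t := by
  have hb : ∃ b ∈ I, t₀ ≤ b ∧ t ≤ b ∧ ∀ᶠ x in 𝓝[I] t, x ≤ b := by
    by_cases h : ∃ c ∈ I, t < c
    · obtain ⟨c, hc, htc⟩ := h
      refine ⟨max c t₀, by rcases max_choice c t₀ with h | h <;> rw [h] <;> assumption,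
        le_max_right _ _, htc.le.trans (le_max_left _ _), ?_⟩
      filter_upwards [nhdsWithin_le_nhds (Iio_mem_nhds htc)] with x hx
      exact (le_of_lt hx).trans (le_max_left _ _)
    · push Not at h
      exact ⟨t, ht, h _ ht₀, le_rfl, by filter_upwards [self_mem_nhdsWithin] using h⟩
  have ha : ∃ a ∈ I, a ≤ t₀ ∧ a ≤ t ∧ ∀ᶠ x in 𝓝[I] t, a ≤ x := by
    by_cases h : ∃ c ∈ I, c < t
    · obtain ⟨c, hc, htc⟩ := h
      refine ⟨min c t₀, by rcases min_choice c t₀ with h | h <;> rw [h] <;> assumption,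
        min_le_right _ _, (min_le_left _ _).trans htc.le, ?_⟩
      filter_upwards [nhdsWithin_le_nhds (Ioi_mem_nhds htc)] with x hx
      exact (min_le_left _ _).trans (le_of_lt hx)
    · push Not at h
      exact ⟨t, ht, h _ ht₀, le_rfl, by filter_upwards [self_mem_nhdsWithin] using h⟩
  obtain ⟨b, hbI, hb1, hb2, hb3⟩ := hb
  obtain ⟨a, haI, ha1, ha2, ha3⟩ := ha
  exact ⟨a, haI, b, hbI, ⟨ha1, hb1⟩, ⟨ha2, hb2⟩, by filter_upwards [ha3, hb3] with x h1 h2 using ⟨h1, h2⟩⟩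

variable {ι : Type*} [Fintype ι] [DecidableEq ι]

/-- `K` is the solution of `K' = A K`, `K t₀ = 1` on `s`. -/
structure IsFundamentalMatrix (A : ℝ → Matrix ι ι ℝ) (t₀ : ℝ) (s : Set ℝ) (K : ℝ → Matrix ι ι ℝ) :
    Prop where
  initial : K t₀ = 1
  hasDeriv : ∀ t ∈ s, ∀ i j, HasDerivWithinAt (fun t => K t i j) ((A t * K t) i j) s t

lemma IsFundamentalMatrix.mono {A : ℝ → Matrix ι ι ℝ} {t₀ : ℝ} {s s' : Set ℝ}
    {K : ℝ → Matrix ι ι ℝ} (h : IsFundamentalMatrix A t₀ s K) (hs : s' ⊆ s) :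
    IsFundamentalMatrix A t₀ s' K :=
  ⟨h.initial, fun t ht i j => (h.hasDeriv t (hs ht) i j).mono hs⟩

/-- If G solves the adjoint equation with coefficient -Aᵀ, then GᵀK has derivative zero. A single H
serves every K, so this gives uniqueness as well as nonsingularity. -/
lemma exists_leftInverse_fundamentalMatrix {a b : ℝ} {A : ℝ → Matrix ι ι ℝ}
    (hA : ∀ i j, ContinuousOn (fun t => A t i j) (Set.Icc a b)) {t₀ : ℝ}
    (ht₀ : t₀ ∈ Set.Icc a b) :
    ∃ H : ℝ → Matrix ι ι ℝ, ∀ K, IsFundamentalMatrix A t₀ (Set.Icc a b) K →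
      ∀ t ∈ Set.Icc a b, H t * K t = 1 := by
  obtain ⟨G, hG0, hG⟩ := exists_fundamentalMatrix_Icc (A := fun t => -(A t)ᵀ)
    (fun i j => (hA j i).neg) ht₀
  refine ⟨fun t => (G t)ᵀ, fun K hK t ht => ?_⟩
  ext i j
  have key : ∀ x ∈ Set.Icc a b,
      HasDerivWithinAt (fun t => ((G t)ᵀ * K t) i j) 0 (Set.Icc a b) x := by
    intro x hx
    simp only [Matrix.mul_apply, Matrix.transpose_apply]
    refine (HasDerivWithinAt.fun_sum fun k _ =>
      (hG x hx k i).fun_mul (hK.hasDeriv x hx k j)).congr_deriv ?_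
    have h1 : ((-(A x)ᵀ * G x)ᵀ * K x + (G x)ᵀ * (A x * K x)) i j = 0 := by
      simp [Matrix.transpose_mul, Matrix.mul_assoc]
    rw [← h1, Matrix.add_apply, Matrix.mul_apply, Matrix.mul_apply, ← Finset.sum_add_distrib]
    rfl
  have h := Convex.norm_image_sub_le_of_norm_hasDerivWithin_le (C := 0) key (by simp)
    (convex_Icc a b) ht₀ ht
  rw [zero_mul, norm_le_zero_iff, sub_eq_zero] at h
  simpa [hG0, hK.initial] using h

theorem exists_isFundamentalMatrix {I : Set ℝ} (hI : I.OrdConnected) {A : ℝ → Matrix ι ι ℝ}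
    (hA : ∀ i j, ContinuousOn (fun t => A t i j) I) {t₀ : ℝ} (ht₀ : t₀ ∈ I) :
    ∃ K, IsFundamentalMatrix A t₀ I K ∧ ∀ t ∈ I, IsUnit (K t) := by
  have ex : ∀ a ∈ I, ∀ b ∈ I, t₀ ∈ Set.Icc a b →
      ∃ K, IsFundamentalMatrix A t₀ (Set.Icc a b) K := fun a ha b hb h =>
    let ⟨K, h0, h1⟩ := exists_fundamentalMatrix_Icc (fun i j => (hA i j).mono (hI.out ha hb)) h
    ⟨K, h0, h1⟩
  have inv : ∀ a ∈ I, ∀ b ∈ I, t₀ ∈ Set.Icc a b → _ := fun a ha b hb h =>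
    exists_leftInverse_fundamentalMatrix (fun i j => (hA i j).mono (hI.out ha hb)) h
  have hmin : ∀ t ∈ I, min t₀ t ∈ I := fun t ht => by
    rcases min_choice t₀ t with h | h <;> rw [h] <;> assumption
  have hmax : ∀ t ∈ I, max t₀ t ∈ I := fun t ht => by
    rcases max_choice t₀ t with h | h <;> rw [h] <;> assumption
  have hm : ∀ t, t₀ ∈ Set.Icc (min t₀ t) (max t₀ t) := fun t => ⟨min_le_left _ _, le_max_left _ _⟩
  have hm' : ∀ t, t ∈ Set.Icc (min t₀ t) (max t₀ t) :=
    fun t => ⟨min_le_right _ _, le_max_right _ _⟩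
  choose! Φ hΦ using fun t (ht : t ∈ I) => ex _ (hmin t ht) _ (hmax t ht) (hm t)
  have agree : ∀ a ∈ I, ∀ b ∈ I, t₀ ∈ Set.Icc a b → ∀ Ψ,
      IsFundamentalMatrix A t₀ (Set.Icc a b) Ψ → ∀ t ∈ Set.Icc a b, Φ t t = Ψ t := by
    intro a ha b hb h Ψ hΨ t ht
    have htI := hI.out ha hb ht
    obtain ⟨H, hH⟩ := inv _ (hmin t htI) _ (hmax t htI) (hm t)
    have h1 := hH _ (hΦ t htI) t (hm' t)
    have h2 := hH _ (hΨ.mono (Set.Icc_subset_Icc (le_min h.1 ht.1) (max_le h.2 ht.2))) t (hm' t)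
    rw [mul_eq_one_comm] at h1
    rw [← Matrix.one_mul (Ψ t), ← h1, Matrix.mul_assoc, h2, Matrix.mul_one]
  -- `Φ t` solves the equation on the interval between t₀ and t; by uniqueness the diagonal agrees
  -- with any solution on a larger compact subinterval, hence solves the equation near t.
  refine ⟨fun t => Φ t t, ⟨(hΦ t₀ ht₀).initial, fun t ht i j => ?_⟩, fun t ht => ?_⟩
  · obtain ⟨a, ha, b, hb, h0, h1, h2⟩ := exists_mem_Icc_mem_nhdsWithin ht₀ ht
    obtain ⟨Ψ, hΨ⟩ := ex a ha b hb h0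
    have hag := agree a ha b hb h0 Ψ hΨ
    have hd := (hΨ.hasDeriv t h1 i j).mono_of_mem_nhdsWithin h2
    simp only [hag t h1]
    exact hd.congr_of_eventuallyEq (by filter_upwards [h2] with x hx using by rw [hag x hx])
      (by simp only [hag t h1])
  · obtain ⟨H, hH⟩ := inv _ (hmin t ht) _ (hmax t ht) (hm t)
    exact IsUnit.of_mul_eq_one_right _ (hH _ (hΦ t ht) t (hm' t))

theorem exists_smooth_fundamentalMatrix {I : Set ℝ} (hI : I.OrdConnected) (hI' : I.Nontrivial)
    {A : ℝ → Matrix ι ι ℝ} (hA : SmoothMat I A) :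
    ∃ K, SmoothMat I K ∧ (∀ t ∈ I, IsUnit (K t)) ∧ ∀ t ∈ I, dMat I K t = A t * K t := by
  have hU := interval_uniqueDiffOn hI hI'
  obtain ⟨t₀, ht₀⟩ := hI'.nonempty
  obtain ⟨K, hK, hu⟩ := exists_isFundamentalMatrix hI (fun i j => (hA i j).continuousOn) ht₀
  have hd : ∀ i j, ∀ t ∈ I, derivWithin (fun t => K t i j) I t = (A t * K t) i j :=
    fun i j t ht => (hK.hasDeriv t ht i j).derivWithin (hU t ht)
  refine ⟨K, fun i j => ?_, hu, fun t ht => by ext i j; exact hd i j t ht⟩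
  rw [contDiffOn_infty]
  intro n
  -- Bootstrapping: if K is of class Cⁿ, so is its derivative A K.
  induction n generalizing i j with
  | zero => exact contDiffOn_zero.2 fun t ht => (hK.hasDeriv t ht i j).continuousWithinAt
  | succ n ih =>
    push_cast
    rw [contDiffOn_succ_iff_derivWithin hU]
    refine ⟨fun t ht => (hK.hasDeriv t ht i j).differentiableWithinAt, by simp, ?_⟩
    refine ContDiffOn.congr ?_ (hd i j)
    simp only [Matrix.mul_apply]
    exact ContDiffOn.sum fun k _ => ((hA i k).of_le (by exact_mod_cast le_top)).mul (ih k j)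

end LinearODE

/-! ### Completion of smooth linearly independent columns. -/

section Completion

variable {I : Set ℝ}

lemma mem_span_range_col {m r : ℕ} {A : Matrix (Fin m) (Fin r) ℝ} {v : Fin m → ℝ} :
    v ∈ Submodule.span ℝ (Set.range A.col) ↔ ∃ z, A *ᵥ z = v := by
  rw [← Matrix.range_mulVecLin]; rfl

/-- The union of all the column spaces is the C¹ image of I × ℝ^r, whose Hausdorff dimension is at
most r + 1 < m; its complement is therefore dense. One constant vector works on the whole interval,
without any patching. -/
lemma exists_const_notMem_span_col (hI : I.OrdConnected) {m r : ℕ} (hr : r + 1 < m)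
    {Y : MatFun m r} (hY : SmoothMat I Y) :
    ∃ v : Fin m → ℝ, ∀ t ∈ I, v ∉ Submodule.span ℝ (Set.range (Y t).col) := by
  have hf : ContDiffOn ℝ 1 (fun q : ℝ × (Fin r → ℝ) => Y q.1 *ᵥ q.2) (I ×ˢ Set.univ) := by
    refine contDiffOn_pi.2 fun i => ?_
    simp only [Matrix.mulVec, dotProduct]
    refine ContDiffOn.sum fun j _ => ?_
    refine ContDiffOn.mul ?_ (by fun_prop)
    exact ((hY i j).of_le (by exact_mod_cast le_top)).comp (t := I) contDiffOn_fst fun q hq => hq.1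
  have hd : dimH (I ×ˢ (Set.univ : Set (Fin r → ℝ))) < Module.finrank ℝ (Fin m → ℝ) := by
    refine (dimH_mono (Set.subset_univ _)).trans_lt ?_
    rw [Real.dimH_univ_eq_finrank]
    simp only [Module.finrank_prod, Module.finrank_self, Module.finrank_fin_fun]
    exact_mod_cast (by omega : 1 + r < m)
  obtain ⟨v, hv⟩ := (hf.dense_compl_image_of_dimH_lt_finrank (hI.convex.prod convex_univ)
    subset_rfl hd).nonempty
  refine ⟨v, fun t ht h => hv ?_⟩
  obtain ⟨z, hz⟩ := mem_span_range_col.1 h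
  exact ⟨(t, z), ⟨ht, trivial⟩, hz⟩

/-- Append the column `v` to the matrix `A`. -/
def appendCol {m r : ℕ} (A : Matrix (Fin m) (Fin r) ℝ) (v : Fin m → ℝ) :
    Matrix (Fin m) (Fin (r + 1)) ℝ :=
  Matrix.of fun i => Fin.snoc (α := fun _ => ℝ) (A i) (v i)

@[simp] lemma appendCol_castSucc {m r : ℕ} (A : Matrix (Fin m) (Fin r) ℝ) (v : Fin m → ℝ)
    (i : Fin m) (j : Fin r) : appendCol A v i j.castSucc = A i j := by simp [appendCol]

@[simp] lemma appendCol_last {m r : ℕ} (A : Matrix (Fin m) (Fin r) ℝ) (v : Fin m → ℝ)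
    (i : Fin m) : appendCol A v i (Fin.last r) = v i := by simp [appendCol]

lemma col_appendCol {m r : ℕ} (A : Matrix (Fin m) (Fin r) ℝ) (v : Fin m → ℝ) :
    (appendCol A v).col = Fin.snoc (α := fun _ => Fin m → ℝ) A.col v := by
  ext j i
  refine Fin.lastCases ?_ (fun j => ?_) j <;> simp [Matrix.col_apply]

lemma linearIndependent_col_appendCol {m r : ℕ} {A : Matrix (Fin m) (Fin r) ℝ} {v : Fin m → ℝ} :
    LinearIndependent ℝ (appendCol A v).col ↔
      LinearIndependent ℝ A.col ∧ v ∉ Submodule.span ℝ (Set.range A.col) := by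
  rw [col_appendCol]; exact linearIndependent_finSnoc

lemma smooth_appendCol {m r : ℕ} {A : MatFun m r} {v : ℝ → Fin m → ℝ} (hA : SmoothMat I A)
    (hv : ∀ i, ContDiffOn ℝ ∞ (fun t => v t i) I) :
    SmoothMat I (fun t => appendCol (A t) (v t)) := fun i j => by
  refine Fin.lastCases ?_ (fun j => ?_) j
  · simpa using hv i
  · simpa using hA i j

/-- The last row of the adjugate of `[A 0]`, the generalized cross product of the columns. -/
noncomputable def crossCol {r : ℕ} (A : Matrix (Fin (r + 1)) (Fin r) ℝ) : Fin (r + 1) → ℝ :=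
  (appendCol A 0).adjugate (Fin.last r)

lemma det_appendCol {r : ℕ} (A : Matrix (Fin (r + 1)) (Fin r) ℝ) (v : Fin (r + 1) → ℝ) :
    (appendCol A v).det = crossCol A ⬝ᵥ v := by
  have h : appendCol A v = (appendCol A 0).updateCol (Fin.last r) v := by
    ext i j
    refine Fin.lastCases ?_ (fun j => ?_) j
    · simp
    · rw [Matrix.updateCol_ne (Fin.castSucc_ne_last j)]; simp
  rw [h, ← Matrix.cramer_apply, Matrix.cramer_eq_adjugate_mulVec]
  rfl

/-- A vector v is outside the span iff det [A v] = crossCol A ⬝ v is nonzero. For v = crossCol A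
this is a sum of squares, and it cannot vanish: otherwise the r columns would span a space of
dimension r + 1. -/
lemma crossCol_notMem_span {r : ℕ} {A : Matrix (Fin (r + 1)) (Fin r) ℝ}
    (hA : LinearIndependent ℝ A.col) :
    crossCol A ∉ Submodule.span ℝ (Set.range A.col) := by
  have key : ∀ v, v ∉ Submodule.span ℝ (Set.range A.col) ↔ crossCol A ⬝ᵥ v ≠ 0 := fun v => by
    rw [← det_appendCol, ← isUnit_iff_ne_zero, ← Matrix.isUnit_iff_isUnit_det,
      ← Matrix.linearIndependent_cols_iff_isUnit, linearIndependent_col_appendCol]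
    simp [hA]
  rw [key]
  intro h
  have h0 : crossCol A = 0 := dotProduct_self_eq_zero.1 h
  have htop : Submodule.span ℝ (Set.range A.col) = ⊤ := by
    rw [eq_top_iff]
    intro v _
    by_contra hv
    exact (key v).1 hv (by simp [h0])
  have h1 := finrank_range_le_card (R := ℝ) A.col
  rw [Set.finrank, htop, finrank_top] at h1
  simp at h1

lemma exists_smooth_notMem_span_col (hI : I.OrdConnected) {m r : ℕ} (hr : r < m)
    {Y : MatFun m r} (hY : SmoothMat I Y) (hli : ∀ t ∈ I, LinearIndependent ℝ (Y t).col) :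
    ∃ v : ℝ → Fin m → ℝ, (∀ i, ContDiffOn ℝ ∞ (fun t => v t i) I) ∧
      ∀ t ∈ I, v t ∉ Submodule.span ℝ (Set.range (Y t).col) := by
  -- The dimension count fails exactly when a single column is missing; there the cross product
  -- takes over.
  rcases Nat.lt_or_ge (r + 1) m with h | h
  · obtain ⟨v, hv⟩ := exists_const_notMem_span_col hI h hY
    exact ⟨fun _ => v, fun i => contDiffOn_const, hv⟩
  · obtain rfl : m = r + 1 := by omega
    refine ⟨fun t => crossCol (Y t), fun i => ?_, fun t ht => crossCol_notMem_span (hli t ht)⟩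
    exact (smooth_appendCol hY (v := fun _ => 0) fun i => contDiffOn_const).adjugate _ _

/-- A smooth matrix function with linearly independent columns can be completed to a pointwise
nonsingular smooth matrix function. -/
theorem exists_completion (hI : I.OrdConnected) {m r : ℕ} (hr : r ≤ m)
    {Y : MatFun m r} (hY : SmoothMat I Y) (hli : ∀ t ∈ I, LinearIndependent ℝ (Y t).col) :
    ∃ T : MatFun m m, SmoothMat I T ∧ (∀ t ∈ I, IsUnit (T t)) ∧
      ∀ t i j, T t i (Fin.castLE hr j) = Y t i j := by
  induction h : m - r generalizing r with
  | zero =>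
    obtain rfl : r = m := by omega
    exact ⟨Y, hY, fun t ht => Matrix.linearIndependent_cols_iff_isUnit.1 (hli t ht),
      fun _ _ _ => rfl⟩
  | succ p ih =>
    obtain ⟨v, hv, hv'⟩ := exists_smooth_notMem_span_col hI (by omega) hY hli
    obtain ⟨T, hT, hu, hTY⟩ := ih (r := r + 1) (by omega) (smooth_appendCol hY hv)
      (fun t ht => linearIndependent_col_appendCol.2 ⟨hli t ht, hv' t ht⟩) (by omega)
    refine ⟨T, hT, hu, fun t i j => ?_⟩
    rw [← appendCol_castSucc (Y t) (v t), ← hTY]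
    rfl

/-- The completion theorem with a separate block for the new columns. -/
theorem exists_block_completion (hI : I.OrdConnected) {m r p : ℕ} (hr : r + p = m)
    {Y : MatFun m r} (hY : SmoothMat I Y) (hli : ∀ t ∈ I, LinearIndependent ℝ (Y t).col) :
    ∃ (Z : MatFun m p) (T' : ℝ → Matrix (Fin r ⊕ Fin p) (Fin m) ℝ),
      SmoothInverse I (fun t => Matrix.fromCols (Y t) (Z t)) T' := by
  subst hr
  obtain ⟨T, hT, hu, hTY⟩ := exists_completion hI (Nat.le_add_right r p) hY hli
  refine ⟨fun t => (T t).submatrix id (Fin.natAdd r),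
    fun t => (T t)⁻¹.submatrix finSumFinEquiv id, ?_⟩
  have h : ∀ t, Matrix.fromCols (Y t) ((T t).submatrix id (Fin.natAdd r)) =
      (T t).submatrix id finSumFinEquiv := fun t => by
    ext i (j | j)
    · exact (hTY t i j).symm
    · rfl
  simp only [h]
  have hT' := SmoothInverse.of_isUnit hT hu
  refine ⟨hT.submatrix _ _, hT'.smooth'.submatrix _ _, fun t ht => ?_, fun t ht => ?_⟩
  · rw [Matrix.submatrix_mul_equiv, hT'.mul_inv t ht, Matrix.submatrix_one _ Function.injective_id]
  · rw [← Matrix.submatrix_mul _ _ _ _ _ Function.bijective_id, hT'.inv_mul t ht,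
      Matrix.submatrix_one _ finSumFinEquiv.injective]

end Completion

/-! ### Invariance of regularity under equivalence. -/

section Invariance

variable {I : Set ℝ}

lemma mem_matIm {m n : ℕ} {A : Matrix (Fin m) (Fin n) ℝ} {v : Fin m → ℝ} :
    v ∈ matIm A ↔ ∃ z, A *ᵥ z = v := Iff.rfl

lemma mem_matKer {m n : ℕ} {A : Matrix (Fin m) (Fin n) ℝ} {z : Fin n → ℝ} :
    z ∈ matKer A ↔ A *ᵥ z = 0 := Iff.rfl

lemma mem_constraintSpace {m : ℕ} {E F : Matrix (Fin m) (Fin m) ℝ} {z : Fin m → ℝ} :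
    z ∈ constraintSpace E F ↔ ∃ w, E *ᵥ w = F *ᵥ z := Iff.rfl

lemma matKer_eq_bot_iff {m n : ℕ} {A : Matrix (Fin m) (Fin n) ℝ} :
    matKer A = ⊥ ↔ LinearIndependent ℝ A.col := by
  rw [← Matrix.mulVec_injective_iff, matKer, LinearMap.ker_eq_bot]; rfl

lemma isUnit_gram {m n : ℕ} {A : Matrix (Fin m) (Fin n) ℝ} (hA : matKer A = ⊥) :
    IsUnit (Aᵀ * A) := by
  rw [← Matrix.linearIndependent_cols_iff_isUnit, ← matKer_eq_bot_iff, matKer,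
    Matrix.ker_mulVecLin_transpose_mul_self]
  exact hA

lemma exists_eq_mul_of_matIm_le {m n r : ℕ} {B : Matrix (Fin m) (Fin n) ℝ}
    {Y : Matrix (Fin m) (Fin r) ℝ} (h : ∀ z, B *ᵥ z ∈ matIm Y) :
    ∃ G : Matrix (Fin r) (Fin n) ℝ, B = Y * G := by
  choose z hz using fun j => mem_matIm.1 (h (Pi.single j 1))
  refine ⟨Matrix.of fun i j => z j i, ?_⟩
  ext i j
  have h1 := congrFun (hz j) i
  rw [Matrix.mulVec_single_one] at h1
  exact h1.symm

/-- Y(YᵀY)⁻¹Yᵀ is the orthogonal projection onto im Y, so it fixes every matrix with columns in im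
Y. -/
lemma mul_gram_inv_mul {m n r : ℕ} {B : Matrix (Fin m) (Fin n) ℝ}
    {Y : Matrix (Fin m) (Fin r) ℝ} (hY : matKer Y = ⊥) (h : ∀ z, B *ᵥ z ∈ matIm Y) :
    Y * ((Yᵀ * Y)⁻¹ * (Yᵀ * B)) = B := by
  obtain ⟨G, rfl⟩ := exists_eq_mul_of_matIm_le h
  rw [← Matrix.mul_assoc Yᵀ, ← Matrix.mul_assoc _ (Yᵀ * Y), Matrix.nonsing_inv_mul _
    ((Matrix.isUnit_iff_isUnit_det _).1 (isUnit_gram hY)), Matrix.one_mul]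

lemma IsSmoothBasis.smoothMat {m r : ℕ} {B : MatFun m r} {W : ℝ → Submodule ℝ (Fin m → ℝ)}
    (h : IsSmoothBasis I B W) : SmoothMat I B := h.smooth

lemma IsSmoothBasis.mem_iff {m r : ℕ} {B : MatFun m r} {W : ℝ → Submodule ℝ (Fin m → ℝ)}
    (h : IsSmoothBasis I B W) {t : ℝ} (ht : t ∈ I) {v : Fin m → ℝ} :
    v ∈ W t ↔ ∃ z, B t *ᵥ z = v := by rw [← h.im_eq t ht]; rfl

/-- Multiplication by a nonsingular matrix transports smooth bases. -/
lemma IsSmoothBasis.mul_left {m r : ℕ} {B : MatFun m r} {W W' : ℝ → Submodule ℝ (Fin m → ℝ)}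
    (h : IsSmoothBasis I B W) {P P' : MatFun m m} (hP : SmoothInverse I P P')
    (hW : ∀ t ∈ I, ∀ v, v ∈ W' t ↔ P' t *ᵥ v ∈ W t) :
    IsSmoothBasis I (fun t => P t * B t) W' where
  smooth := hP.smooth.mul h.smoothMat
  ker_eq t ht := by
    rw [Submodule.eq_bot_iff]
    intro z hz
    rw [mem_matKer, ← Matrix.mulVec_mulVec] at hz
    have h1 : B t *ᵥ z = 0 := by
      rw [← Matrix.one_mulVec (B t *ᵥ z), ← hP.inv_mul t ht, ← Matrix.mulVec_mulVec, hz,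
        Matrix.mulVec_zero]
    exact (Submodule.eq_bot_iff _).1 (h.ker_eq t ht) z h1
  im_eq t ht := by
    ext v
    rw [hW t ht, h.mem_iff ht, mem_matIm]
    refine exists_congr fun z => ?_
    rw [← Matrix.mulVec_mulVec]
    constructor
    · rintro rfl; rw [Matrix.mulVec_mulVec, hP.inv_mul t ht, Matrix.one_mulVec]
    · intro h1; rw [h1, Matrix.mulVec_mulVec, hP.mul_inv t ht, Matrix.one_mulVec]

variable {m : ℕ} {E F : MatFun m m}

/-- Used with D the derivative of C: no information on the second matrix of the reduced pair is lost
by multiplying with Yᵀ. -/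
lemma mulVec_mem_matIm_of_constraint {r : ℕ} {E F : Matrix (Fin m) (Fin m) ℝ}
    {C D : Matrix (Fin m) (Fin r) ℝ} (hC : ∀ z, C *ᵥ z ∈ constraintSpace E F) (z : Fin r → ℝ) :
    (F * C + E * D) *ᵥ z ∈ matIm E := by
  obtain ⟨w, hw⟩ := mem_constraintSpace.1 (hC z)
  refine mem_matIm.2 ⟨w + D *ᵥ z, ?_⟩
  rw [Matrix.mulVec_add, hw, Matrix.add_mulVec, Matrix.mulVec_mulVec, Matrix.mulVec_mulVec]

lemma mem_matIm_transform {E E' L L' K K' : Matrix (Fin m) (Fin m) ℝ} (hL : L * L' = 1)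
    (hL' : L' * L = 1) (hK : K * K' = 1) (hE : E' = L * E * K) {v : Fin m → ℝ} :
    v ∈ matIm E' ↔ L' *ᵥ v ∈ matIm E := by
  rw [mem_matIm, mem_matIm, hE]
  constructor
  · rintro ⟨z, rfl⟩
    refine ⟨K *ᵥ z, ?_⟩
    rw [Matrix.mulVec_mulVec, Matrix.mulVec_mulVec, ← Matrix.mul_assoc, ← Matrix.mul_assoc, hL',
      Matrix.one_mul]
  · rintro ⟨z, hz⟩
    refine ⟨K' *ᵥ z, ?_⟩
    rw [Matrix.mulVec_mulVec, Matrix.mul_assoc, hK, Matrix.mul_one, ← Matrix.mulVec_mulVec, hz,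
      Matrix.mulVec_mulVec, hL, Matrix.one_mulVec]

/-- The derivative term L E D changes F' v only by a vector of im E', so it does not affect
membership. -/
lemma mem_constraintSpace_transform {E F E' F' L L' K K' D : Matrix (Fin m) (Fin m) ℝ}
    (hL : L * L' = 1) (hL' : L' * L = 1) (hK : K * K' = 1) (hE : E' = L * E * K)
    (hF : F' = L * F * K + L * E * D) {v : Fin m → ℝ} :
    v ∈ constraintSpace E' F' ↔ K *ᵥ v ∈ constraintSpace E F := by
  have h : v ∈ constraintSpace E' F' ↔ F' *ᵥ v ∈ matIm E' := Iff.rfl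
  have h' : K *ᵥ v ∈ constraintSpace E F ↔ F *ᵥ (K *ᵥ v) ∈ matIm E := Iff.rfl
  have h1 : L' *ᵥ (F' *ᵥ v) = F *ᵥ (K *ᵥ v) + E *ᵥ (D *ᵥ v) := by
    rw [hF, Matrix.mulVec_mulVec, Matrix.mul_add]
    simp only [Matrix.mul_assoc, ← Matrix.mul_assoc L' L, hL', Matrix.one_mul, Matrix.add_mulVec,
      Matrix.mulVec_mulVec]
  rw [h, h', mem_matIm_transform hL hL' hK hE, h1,
    Submodule.add_mem_iff_left _ (mem_matIm.2 ⟨_, rfl⟩)]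

lemma IsPreRegular.transform {r θ : ℕ} (h : IsPreRegular I E F r θ) {E' F' L L' K K' : MatFun m m}
    (hL : SmoothInverse I L L') (hK : SmoothInverse I K K')
    (hE : ∀ t ∈ I, E' t = L t * E t * K t)
    (hF : ∀ t ∈ I, F' t = L t * F t * K t + L t * E t * dMat I K t) :
    IsPreRegular I E' F' r θ where
  im_sup_im t ht := by
    rw [eq_top_iff]
    intro v _
    have h1 : L' t *ᵥ v ∈ matIm (E t) ⊔ matIm (F t) := by rw [h.im_sup_im t ht]; trivial
    obtain ⟨_, ⟨x, rfl⟩, _, ⟨y, rfl⟩, hxy⟩ := Submodule.mem_sup.1 h1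
    refine Submodule.mem_sup.2 ⟨v - F' t *ᵥ (K' t *ᵥ y), ?_, _, ⟨K' t *ᵥ y, rfl⟩,
      sub_add_cancel _ _⟩
    rw [mem_matIm_transform (hL.mul_inv t ht) (hL.inv_mul t ht) (hK.mul_inv t ht) (hE t ht)]
    refine mem_matIm.2 ⟨x - dMat I K t *ᵥ (K' t *ᵥ y), ?_⟩
    have h2 : L' t *ᵥ (F' t *ᵥ (K' t *ᵥ y)) = F t *ᵥ y + E t *ᵥ (dMat I K t *ᵥ (K' t *ᵥ y)) := by
      rw [hF t ht, Matrix.mulVec_mulVec, Matrix.mul_add]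
      simp only [Matrix.mul_assoc, ← Matrix.mul_assoc (L' t) (L t), hL.inv_mul t ht,
        Matrix.one_mul, Matrix.add_mul, Matrix.add_mulVec, Matrix.mulVec_mulVec, hK.mul_inv t ht,
        Matrix.mul_one]
    rw [Matrix.mulVec_sub, Matrix.mulVec_sub, h2, ← hxy]
    simp only [Matrix.mulVecLin_apply]
    abel
  rank_eq t ht := by
    rw [hE t ht, Matrix.rank_mul_eq_left_of_isUnit_det _ _
      ((Matrix.isUnit_iff_isUnit_det _).1 (hK.isUnit ht)), Matrix.rank_mul_eq_right_of_isUnit_det _ _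
      ((Matrix.isUnit_iff_isUnit_det _).1 (hL.isUnit ht)), h.rank_eq t ht]
  finrank_inf t ht := by
    rw [← h.finrank_inf t ht]
    let e : (Fin m → ℝ) ≃ₗ[ℝ] (Fin m → ℝ) :=
      Matrix.toLin'OfInv (hK.inv_mul t ht) (hK.mul_inv t ht)
    have he : matKer (E' t) ⊓ constraintSpace (E' t) (F' t) =
        (matKer (E t) ⊓ constraintSpace (E t) (F t)).comap (e : (Fin m → ℝ) →ₗ[ℝ] (Fin m → ℝ)) := by
      ext z
      have hz : e z = K t *ᵥ z := Matrix.toLin'_apply _ _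
      rw [Submodule.mem_inf, mem_constraintSpace_transform (hL.mul_inv t ht) (hL.inv_mul t ht)
        (hK.mul_inv t ht) (hE t ht) (hF t ht), Submodule.mem_comap, Submodule.mem_inf,
        LinearEquiv.coe_coe, hz]
      refine and_congr_left fun _ => ?_
      rw [mem_matKer, mem_matKer, hE t ht, ← Matrix.mulVec_mulVec, ← Matrix.mulVec_mulVec]
      constructor
      · intro h1
        rw [← Matrix.one_mulVec (E t *ᵥ _), ← hL.inv_mul t ht, ← Matrix.mulVec_mulVec, h1,
          Matrix.mulVec_zero]
      · intro h1; rw [h1, Matrix.mulVec_zero]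
    rw [he]
    exact (LinearEquiv.ofSubmodule' e _).finrank_eq

/-- With the bases LY and K⁻¹C, the new reduced pair is W times the old one, where W =
(LY)ᵀ(LY)(YᵀY)⁻¹ is nonsingular: the columns of EC and FC + E dC/dt lie in im Y, and the derivatives
of K and K⁻¹ cancel. -/
theorem IsRegularOfIndex.of_pairEquivGen (hU : UniqueDiffOn ℝ I) {μ : ℕ} {m : ℕ}
    {E F E' F' : MatFun m m} (h : PairEquivGen I E F E' F') (hr : IsRegularOfIndex I μ E F) :
    IsRegularOfIndex I μ E' F' := by
  induction μ generalizing m with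
  | zero =>
    obtain ⟨L, L', K, K', hL, hK, hE, hF⟩ := h
    intro t ht
    rw [hE t ht]
    exact ((hL.isUnit ht).mul (hr t ht)).mul (hK.isUnit ht)
  | succ μ ih =>
    obtain ⟨L, L', K, K', hL, hK, hE, hF⟩ := h
    obtain ⟨r, θ, hrm, hpre, Y, C, hY, hC, hred⟩ := hr
    refine ⟨r, θ, hrm, hpre.transform hL hK hE hF, fun t => L t * Y t, fun t => K' t * C t,
      hY.mul_left hL fun t ht v => mem_matIm_transform (hL.mul_inv t ht) (hL.inv_mul t ht)
        (hK.mul_inv t ht) (hE t ht),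
      hC.mul_left hK.symm fun t ht v => mem_constraintSpace_transform (hL.mul_inv t ht)
        (hL.inv_mul t ht) (hK.mul_inv t ht) (hE t ht) (hF t ht), ?_⟩
    refine ih ?_ hred
    have hG : ∀ t ∈ I, IsUnit ((Y t)ᵀ * Y t) := fun t ht => isUnit_gram (hY.ker_eq t ht)
    have hGL : ∀ t ∈ I, IsUnit ((L t * Y t)ᵀ * (L t * Y t)) := fun t ht => isUnit_gram
      ((hY.mul_left hL (W' := fun t => (matIm (E t)).comap (L' t).mulVecLin)
        fun t ht v => Iff.rfl).ker_eq t ht)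
    have hWs := (SmoothInverse.of_isUnit ((hL.smooth.mul hY.smoothMat).transpose.mul
      (hL.smooth.mul hY.smoothMat)) hGL).mul
      (SmoothInverse.of_isUnit (hY.smoothMat.transpose.mul hY.smoothMat) hG).symm
    have hW : ∀ t ∈ I, ∀ B : Matrix (Fin m) (Fin r) ℝ, (∀ z, B *ᵥ z ∈ matIm (Y t)) →
        (L t * Y t)ᵀ * (L t * Y t) * ((Y t)ᵀ * Y t)⁻¹ * ((Y t)ᵀ * B) = (L t * Y t)ᵀ * (L t * B) := by
      intro t ht B hB
      conv_rhs => rw [← mul_gram_inv_mul (hY.ker_eq t ht) hB]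
      simp only [Matrix.mul_assoc]
    have hCmem : ∀ t ∈ I, ∀ z, C t *ᵥ z ∈ constraintSpace (E t) (F t) := fun t ht z =>
      (hC.mem_iff ht).2 ⟨z, rfl⟩
    refine (PairEquivGen.mul_left hWs).trans hU (PairEquivGen.of_eq ?_ ?_)
    · intro t ht
      simp only
      rw [Matrix.mul_assoc (Y t)ᵀ, hW t ht _ fun z => by
          rw [hY.im_eq t ht, ← Matrix.mulVec_mulVec]; exact mem_matIm.2 ⟨_, rfl⟩, hE t ht]
      simp only [Matrix.mul_assoc, ← Matrix.mul_assoc (K t) (K' t), hK.mul_inv t ht, Matrix.one_mul]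
    · intro t ht
      simp only
      change (L t * Y t)ᵀ * F' t * (K' t * C t) +
        (L t * Y t)ᵀ * E' t * dMat I (fun t => K' t * C t) t = _ * _ * ((Y t)ᵀ * F t * C t +
          (Y t)ᵀ * E t * dMat I C t)
      have hd : dMat I K t * K' t + K t * dMat I K' t = 0 := by
        rw [← dMat_mul hU hK.smooth hK.smooth' ht, dMat_congr hK.mul_inv ht, dMat_const]
      have hB : (Y t)ᵀ * F t * C t + (Y t)ᵀ * E t * dMat I C t =
          (Y t)ᵀ * (F t * C t + E t * dMat I C t) := by
        simp only [Matrix.mul_add, Matrix.mul_assoc]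
      rw [hB, hW t ht _ fun z => by
        rw [hY.im_eq t ht]; exact mulVec_mem_matIm_of_constraint (hCmem t ht) z,
        dMat_mul hU hK.smooth' hC.smoothMat ht]
      have h1 : F' t * (K' t * C t) + E' t * (dMat I K' t * C t + K' t * dMat I C t) =
          L t * (F t * (K t * K' t) * C t + E t * (K t * K' t) * dMat I C t +
          E t * (dMat I K t * K' t + K t * dMat I K' t) * C t) := by
        rw [hF t ht, hE t ht]
        simp only [Matrix.mul_add, Matrix.add_mul, Matrix.mul_assoc]
        abel
      rw [Matrix.mul_assoc _ (F' t), Matrix.mul_assoc _ (E' t), ← Matrix.mul_add, h1, hd,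
        hK.mul_inv t ht]
      simp

lemma exists_basisMatrix {n r : ℕ} (W : Submodule ℝ (Fin n → ℝ)) (hr : Module.finrank ℝ W = r) :
    ∃ Y : Matrix (Fin n) (Fin r) ℝ, matKer Y = ⊥ ∧ matIm Y = W := by
  let b := Module.finBasisOfFinrankEq ℝ W hr
  refine ⟨Matrix.of fun i j => (b j : Fin n → ℝ) i, ?_, ?_⟩
  · rw [matKer_eq_bot_iff]
    exact b.linearIndependent.map' W.subtype (Submodule.ker_subtype W)
  · rw [matIm, Matrix.range_mulVecLin]
    change Submodule.span ℝ (Set.range (W.subtype ∘ b)) = W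
    rw [Set.range_comp, ← Submodule.map_span, b.span_eq, Submodule.map_top, Submodule.range_subtype]

/-- A constant pair `{M, 1}` is regular. -/
theorem isRegularPair_const (hU : UniqueDiffOn ℝ I) {n : ℕ} (M : Matrix (Fin n) (Fin n) ℝ) :
    IsRegularPair I (fun _ => M) (fun _ => 1) := by
  induction n using Nat.strong_induction_on with
  | _ n ih =>
    by_cases hM : IsUnit M
    · exact ⟨0, fun _ _ => hM⟩
    have hrank : M.rank < n := by
      refine lt_of_le_of_ne (by simpa using M.rank_le_width) fun h => hM ?_
      rw [← Matrix.mulVec_surjective_iff_isUnit]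
      have : LinearMap.range M.mulVecLin = ⊤ :=
        Submodule.eq_top_of_finrank_eq (by rw [Module.finrank_fin_fun]; exact h)
      exact LinearMap.range_eq_top.1 this
    have hS : constraintSpace M 1 = matIm M := by
      ext z; simp [constraintSpace]
    obtain ⟨Y, hY0, hY⟩ := exists_basisMatrix (matIm M) (r := M.rank) rfl
    have hYb : ∀ W : ℝ → Submodule ℝ (Fin n → ℝ), (∀ t, W t = matIm M) →
        IsSmoothBasis I (fun _ => Y) W := fun W hW =>
      ⟨SmoothMat.const Y, fun _ _ => hY0, fun t _ => by rw [hW, hY]⟩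
    -- With both bases equal to Y the reduced pair is {YᵀMY, YᵀY}; dividing by the Gram matrix
    -- restores the form {M', 1}, with M' representing M on im M.
    obtain ⟨μ, hμ⟩ := ih _ hrank ((Yᵀ * Y)⁻¹ * (Yᵀ * M * Y))
    refine ⟨μ + 1, M.rank, _, hrank, ⟨fun t _ => ?_, fun _ _ => rfl, fun _ _ => rfl⟩, fun _ => Y,
      fun _ => Y, hYb _ fun _ => rfl, hYb _ fun _ => hS, ?_⟩
    · rw [eq_top_iff]
      exact fun v _ => Submodule.mem_sup_right (mem_matIm.2 ⟨v, Matrix.one_mulVec v⟩)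
    · refine hμ.of_pairEquivGen hU ((PairEquivGen.mul_left (SmoothInverse.of_isUnit
        (SmoothMat.const (Yᵀ * Y)) fun _ _ => isUnit_gram hY0)).trans hU
        (PairEquivGen.of_eq (fun t _ => ?_) fun t _ => ?_))
      · exact (Matrix.mul_nonsing_inv_cancel_left _ _
          ((Matrix.isUnit_iff_isUnit_det _).1 (isUnit_gram hY0))).symm
      · have hd : MatFun.derivOn I (fun _ => Y) t = 0 := dMat_const Y t
        simp [hd]

end Invariance

/-! ### Elementary pairs are regular. -/

section Elementary

variable {I : Set ℝ} {ι κ : Type*} [Fintype ι] [Fintype κ] [DecidableEq ι] [DecidableEq κ]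

/-- Scaling the leading unknowns by exp((β - α)t) and the equations by its inverse adds β - α to the
coefficient α. -/
lemma pairEquivGen_exp (hU : UniqueDiffOn ℝ I) (N : Matrix κ κ ℝ) (α β : ℝ) :
    PairEquivGen I (fun _ => Matrix.fromBlocks (1 : Matrix ι ι ℝ) 0 0 N)
      (fun _ => Matrix.fromBlocks (α • 1 : Matrix ι ι ℝ) 0 0 1)
      (fun _ => Matrix.fromBlocks (1 : Matrix ι ι ℝ) 0 0 N)
      (fun _ => Matrix.fromBlocks (β • 1 : Matrix ι ι ℝ) 0 0 1) := by
  have hs : ∀ c : ℝ, SmoothMat I (fun t => Real.exp (c * t) • (1 : Matrix ι ι ℝ)) := fun c i j => by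
    simp only [Matrix.smul_apply, smul_eq_mul]
    exact ContDiffOn.mul (ContDiff.contDiffOn (by fun_prop)) contDiffOn_const
  have hinv : ∀ c : ℝ, SmoothInverse I (fun t => Real.exp (c * t) • (1 : Matrix ι ι ℝ))
      (fun t => Real.exp (-c * t) • 1) := fun c =>
    ⟨hs c, hs (-c), fun t _ => by simp [smul_smul, ← Real.exp_add],
      fun t _ => by simp [smul_smul, ← Real.exp_add]⟩
  have hd : ∀ t ∈ I, dMat I (fun t => Real.exp ((β - α) * t) • (1 : Matrix ι ι ℝ)) t =
      ((β - α) * Real.exp ((β - α) * t)) • 1 := fun t ht => by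
    ext i j
    simp only [dMat, Matrix.of_apply, Matrix.smul_apply, smul_eq_mul]
    have h1 : HasDerivAt (fun t => Real.exp ((β - α) * t)) ((β - α) * Real.exp ((β - α) * t)) t := by
      simpa [mul_comm] using ((hasDerivAt_id t).const_mul (β - α)).exp
    exact (h1.mul_const _).hasDerivWithinAt.derivWithin (hU t ht)
  have hexp : ∀ t, Real.exp ((β - α) * t) * Real.exp ((α - β) * t) = 1 := fun t => by
    rw [← Real.exp_add, ← add_mul, sub_add_sub_cancel', sub_self, zero_mul, Real.exp_zero]
  refine ⟨_, _, _, _, (hinv (β - α)).symm.diagonal .one, (hinv (β - α)).diagonal .one,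
    fun t ht => ?_, fun t ht => ?_⟩
  · simp [Matrix.fromBlocks_multiply, smul_smul, hexp]
  · rw [dMat_fromBlocks, hd t ht]
    have h0 : dMat I (fun _ => (0 : Matrix ι κ ℝ)) t = 0 := dMat_const 0 t
    have h0' : dMat I (fun _ => (0 : Matrix κ ι ℝ)) t = 0 := dMat_const 0 t
    have h1 : dMat I (fun _ => (1 : Matrix κ κ ℝ)) t = 0 := dMat_const 1 t
    rw [h0, h0', h1]
    simp only [Matrix.fromBlocks_multiply, Matrix.fromBlocks_add]
    simp only [neg_sub, Matrix.mul_smul, Matrix.mul_one, Matrix.mul_zero,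
      Matrix.zero_mul, add_zero, zero_add, smul_smul, ← add_smul, smul_zero]
    congr 2
    linear_combination (-β) * hexp t

/-- Moving α to 1 makes the second matrix the identity, so that `isRegularPair_const` applies. -/
theorem isRegularPair_of_equivToElementary (hU : UniqueDiffOn ℝ I) {m : ℕ} {E F : MatFun m m}
    {α : ℝ} {P : ∀ {μ : ℕ}, (Fin μ → ℕ) → Prop} (h : EquivToElementary I E F α P) :
    IsRegularPair I E F := by
  obtain ⟨d, μ, ℓ, hm, -, -, heq⟩ := h
  have h1 := PairEquivGen.pairEquiv_iff.2 heq
  have h2 : PairEquivGen I (fun _ => Matrix.fromBlocks 1 0 0 (elemNilpotent ℓ))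
      (fun _ => Matrix.fromBlocks (α • 1) 0 0 1)
      (fun _ => blockDiag₂ hm 1 (elemNilpotent ℓ)) (fun _ => blockDiag₂ hm (α • 1) 1) :=
    PairEquivGen.submatrix (blockIndex hm)
  have h3 := (h2.symm hU).trans hU (pairEquivGen_exp hU (elemNilpotent ℓ) α 1)
  have h4 := (h3.trans hU (PairEquivGen.submatrix (blockIndex hm))).symm hU
  simp only [one_smul, Matrix.fromBlocks_one, Matrix.submatrix_one_equiv] at h4
  obtain ⟨k, hk⟩ := isRegularPair_const hU (blockDiag₂ hm 1 (elemNilpotent ℓ))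
  exact ⟨k, hk.of_pairEquivGen hU (h4.trans hU (h1.symm hU))⟩

end Elementary

/-! ### One reduction step as a bordered normal form. -/

section Reduction

variable {I : Set ℝ}

/-- Splitting off the algebraic equations of a pair: the leading block is the reduced pair. -/
theorem exists_bordered_form (hI : I.OrdConnected) (hU : UniqueDiffOn ℝ I) {m r p : ℕ}
    (hr : r + p = m) {E F : MatFun m m} (hE : SmoothMat I E) (hF : SmoothMat I F)
    (htop : ∀ t ∈ I, matIm (E t) ⊔ matIm (F t) = ⊤) {Y C : MatFun m r}
    (hY : IsSmoothBasis I Y fun t => matIm (E t))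
    (hC : IsSmoothBasis I C fun t => constraintSpace (E t) (F t)) :
    ∃ B : ℝ → Matrix (Fin r) (Fin p) ℝ, SmoothMat I B ∧
      (∀ t ∈ I, Function.Surjective (Matrix.fromCols ((Y t)ᵀ * E t * C t) (B t)).mulVec) ∧
      PairEquivGen I E F (fun t => Matrix.fromBlocks ((Y t)ᵀ * E t * C t) (B t) 0 0)
        (fun t => Matrix.fromBlocks ((Y t)ᵀ * F t * C t + (Y t)ᵀ * E t * dMat I C t) 0 0 1) := by
  have hYs := hY.smoothMat
  have hCs := hC.smoothMat
  have hG : ∀ t ∈ I, IsUnit ((Y t)ᵀ * Y t) := fun t ht => isUnit_gram (hY.ker_eq t ht)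
  obtain ⟨Z, T', hT⟩ := exists_block_completion hI hr hYs
    fun t ht => matKer_eq_bot_iff.1 (hY.ker_eq t ht)
  obtain ⟨D, K', hK⟩ := exists_block_completion hI hr hCs
    fun t ht => matKer_eq_bot_iff.1 (hC.ker_eq t ht)
  have hDs : SmoothMat I D := fun i j => hK.smooth i (Sum.inr j)
  have hTY : ∀ t ∈ I, T' t * Y t = Matrix.fromRows 1 0 := fun t ht => by
    have h1 := hT.inv_mul t ht
    rw [Matrix.mul_fromCols, ← Matrix.fromBlocks_one, ← Matrix.fromCols_fromRows_eq_fromBlocks]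
      at h1
    exact (Matrix.fromCols_inj h1).1
  -- L = diag(YᵀY, I)[Y Z]⁻¹; the factor YᵀY makes L B equal to [YᵀB; 0] whenever B maps into im E,
  -- so exactly the reduced pair appears.
  obtain ⟨L, L', hL, hLT⟩ : ∃ (L : ℝ → Matrix (Fin r ⊕ Fin p) (Fin m) ℝ)
      (L' : ℝ → Matrix (Fin m) (Fin r ⊕ Fin p) ℝ), SmoothInverse I L L' ∧
      ∀ t ∈ I, L t * Y t = Matrix.fromRows ((Y t)ᵀ * Y t) 0 := by
    refine ⟨_, _, (SmoothInverse.diagonal (SmoothInverse.of_isUnit (hYs.transpose.mul hYs) hG)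
      (SmoothInverse.one (ι := Fin p))).mul hT.symm, fun t ht => ?_⟩
    rw [Matrix.mul_assoc, hTY t ht, Matrix.fromBlocks_mul_fromRows]
    simp
  have hLB : ∀ t ∈ I, ∀ n : ℕ, ∀ B : Matrix (Fin m) (Fin n) ℝ, (∀ z, B *ᵥ z ∈ matIm (E t)) →
      L t * B = Matrix.fromRows ((Y t)ᵀ * B) 0 := fun t ht n B hB => by
    obtain ⟨G, rfl⟩ := exists_eq_mul_of_matIm_le (Y := Y t)
      fun z => by rw [hY.im_eq t ht]; exact hB z
    rw [← Matrix.mul_assoc, hLT t ht, Matrix.fromRows_mul, Matrix.zero_mul, Matrix.mul_assoc]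
  have hCmem : ∀ t ∈ I, ∀ z, C t *ᵥ z ∈ constraintSpace (E t) (F t) := fun t ht z =>
    (hC.mem_iff ht).2 ⟨z, rfl⟩
  have hEim : ∀ t, ∀ n : ℕ, ∀ B : Matrix (Fin m) (Fin n) ℝ, ∀ z,
      (E t * B) *ᵥ z ∈ matIm (E t) := fun t n B z => mem_matIm.2 ⟨_, Matrix.mulVec_mulVec _ _ _⟩
  set G : ℝ → Matrix (Fin r ⊕ Fin p) (Fin p) ℝ :=
    fun t => L t * (F t * D t + E t * dMat I D t) with hGdef
  have hGs : SmoothMat I G := hL.smooth.mul ((hF.mul hDs).add (hE.mul (hDs.derivative hU)))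
  have hdK : ∀ t, dMat I (fun t => Matrix.fromCols (C t) (D t)) t =
      Matrix.fromCols (dMat I C t) (dMat I D t) := fun t => by ext i (j | j) <;> rfl
  have step1 : PairEquivGen I E F
      (fun t => Matrix.fromBlocks ((Y t)ᵀ * E t * C t) ((Y t)ᵀ * E t * D t) 0 0)
      (fun t => Matrix.fromBlocks ((Y t)ᵀ * F t * C t + (Y t)ᵀ * E t * dMat I C t)
        (G t).toRows₁ 0 (G t).toRows₂) := by
    refine ⟨L, _, _, _, hL, hK, fun t ht => ?_, fun t ht => ?_⟩
    · rw [Matrix.mul_assoc, Matrix.mul_fromCols, Matrix.mul_fromCols, hLB t ht _ _ (hEim t _ _),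
        hLB t ht _ _ (hEim t _ _), Matrix.fromCols_fromRows_eq_fromBlocks]
      simp only [Matrix.mul_assoc]
    · rw [hdK, Matrix.mul_assoc, Matrix.mul_assoc, ← Matrix.mul_add, Matrix.mul_fromCols,
        Matrix.mul_fromCols]
      have h1 : Matrix.fromCols (F t * C t) (F t * D t) +
          Matrix.fromCols (E t * dMat I C t) (E t * dMat I D t) =
          Matrix.fromCols (F t * C t + E t * dMat I C t) (F t * D t + E t * dMat I D t) := by
        ext i (j | j) <;> rfl
      rw [h1, Matrix.mul_fromCols, hLB t ht _ _ (mulVec_mem_matIm_of_constraint (hCmem t ht))]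
      change _ = Matrix.fromCols _ (G t)
      conv_rhs => rw [← Matrix.fromRows_toRows (G t), Matrix.fromCols_fromRows_eq_fromBlocks]
      simp only [Matrix.mul_assoc, Matrix.mul_add]
  -- The bottom rows of L annihilate im E, hence also FC; only D contributes there, and im [E F] =
  -- ℝ^m makes its contribution surjective.
  have hW : ∀ t ∈ I, IsUnit (G t).toRows₂ := fun t ht => by
    rw [← Matrix.mulVec_surjective_iff_isUnit]
    intro w
    obtain ⟨v, hv⟩ : ∃ v, L t *ᵥ v = Sum.elim (0 : Fin r → ℝ) w :=
      ⟨L' t *ᵥ Sum.elim 0 w, by rw [Matrix.mulVec_mulVec, hL.mul_inv t ht, Matrix.one_mulVec]⟩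
    have hvt : v ∈ matIm (E t) ⊔ matIm (F t) := by rw [htop t ht]; trivial
    obtain ⟨_, ⟨x, rfl⟩, _, ⟨y, rfl⟩, rfl⟩ := Submodule.mem_sup.1 hvt
    have hE0 : ∀ x i, (L t *ᵥ (E t *ᵥ x)) (Sum.inr i) = 0 := fun x i => by
      rw [Matrix.mulVec_mulVec, hLB t ht _ _ fun z => mem_matIm.2 ⟨_, rfl⟩,
        Matrix.fromRows_mulVec]
      simp
    set q := K' t *ᵥ y with hq
    have hy : y = C t *ᵥ (q ∘ Sum.inl) + D t *ᵥ (q ∘ Sum.inr) := by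
      rw [← Matrix.fromCols_mulVec, hq, Matrix.mulVec_mulVec, hK.mul_inv t ht, Matrix.one_mulVec]
    refine ⟨q ∘ Sum.inr, funext fun i => ?_⟩
    obtain ⟨c, hc⟩ := mem_constraintSpace.1 (hCmem t ht (q ∘ Sum.inl))
    have h2 := congrFun hv (Sum.inr i)
    rw [Sum.elim_inr] at h2
    rw [← h2, Matrix.mulVecLin_apply, Matrix.mulVecLin_apply, hy, Matrix.mulVec_add,
      Matrix.mulVec_add, Matrix.mulVec_add, ← hc]
    have h3 : ((G t).toRows₂ *ᵥ (q ∘ Sum.inr)) i = (G t *ᵥ (q ∘ Sum.inr)) (Sum.inr i) := rfl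
    rw [h3, hGdef]
    simp only [← Matrix.mulVec_mulVec, Matrix.add_mulVec, Matrix.mulVec_add, Pi.add_apply, hE0]
    ring
  have hWs := SmoothInverse.of_isUnit (L := fun t => (G t).toRows₂)
    (fun i j => hGs (Sum.inr i) j) hW
  have hG1 : SmoothMat I fun t => (G t).toRows₁ := fun i j => hGs (Sum.inl i) j
  -- The row operations that clear G leave the first matrix unchanged, because its bottom rows are
  -- zero.
  refine ⟨fun t => (Y t)ᵀ * E t * D t, (hYs.transpose.mul hE).mul hDs, fun t ht w => ?_,
    (step1.trans hU (PairEquivGen.mul_left (SmoothInverse.upperTriangular .one hWs.symm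
      (hG1.mul hWs.smooth').neg))).trans hU (PairEquivGen.of_eq (fun t ht => ?_) fun t ht => ?_)⟩
  -- Y(YᵀY)⁻¹w lies in im E, say equal to E x; then Yᵀ E x = w.
  · obtain ⟨x, hx⟩ := mem_matIm.1 ((hY.mem_iff ht).2 ⟨((Y t)ᵀ * Y t)⁻¹ *ᵥ w, rfl⟩)
    refine ⟨K' t *ᵥ x, ?_⟩
    rw [← Matrix.mul_fromCols, Matrix.mulVec_mulVec, Matrix.mul_assoc, hK.mul_inv t ht,
      Matrix.mul_one, ← Matrix.mulVec_mulVec, hx, Matrix.mulVec_mulVec, Matrix.mulVec_mulVec,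
      Matrix.mul_nonsing_inv _ ((Matrix.isUnit_iff_isUnit_det _).1 (hG t ht)), Matrix.one_mulVec]
  · simp [Matrix.fromBlocks_multiply]
  · simp [Matrix.fromBlocks_multiply, Matrix.mul_assoc, hWs.inv_mul t ht]

variable {ι κ ρ : Type*} [Fintype ι] [Fintype κ] [Fintype ρ] [DecidableEq ι] [DecidableEq κ]
  [DecidableEq ρ]

/-- An equivalence of the leading blocks extends to the bordered pairs. -/
theorem exists_bordered_transfer {E F : ℝ → Matrix ι ι ℝ} {E' F' : ℝ → Matrix κ κ ℝ}
    (h : PairEquivGen I E F E' F') {B : ℝ → Matrix ι ρ ℝ} (hB : SmoothMat I B)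
    (hs : ∀ t ∈ I, Function.Surjective (Matrix.fromCols (E t) (B t)).mulVec) :
    ∃ B' : ℝ → Matrix κ ρ ℝ, SmoothMat I B' ∧
      (∀ t ∈ I, Function.Surjective (Matrix.fromCols (E' t) (B' t)).mulVec) ∧
      PairEquivGen I (fun t => Matrix.fromBlocks (E t) (B t) 0 0)
        (fun t => Matrix.fromBlocks (F t) 0 0 1) (fun t => Matrix.fromBlocks (E' t) (B' t) 0 0)
        (fun t => Matrix.fromBlocks (F' t) 0 0 1) := by
  obtain ⟨L, L', K, K', hL, hK, hE, hF⟩ := h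
  refine ⟨fun t => L t * B t, hL.smooth.mul hB, fun t ht w => ?_, _, _, _, _,
    hL.diagonal .one, hK.diagonal .one, fun t ht => ?_, fun t ht => ?_⟩
  · obtain ⟨z, hz⟩ := hs t ht (L' t *ᵥ w)
    refine ⟨Sum.elim (K' t *ᵥ (z ∘ Sum.inl)) (z ∘ Sum.inr), ?_⟩
    rw [Matrix.fromCols_mulVec] at hz ⊢
    rw [Sum.elim_comp_inl, Sum.elim_comp_inr, hE t ht, Matrix.mulVec_mulVec, Matrix.mul_assoc,
      hK.mul_inv t ht, Matrix.mul_one, ← Matrix.mulVec_mulVec, ← Matrix.mulVec_mulVec,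
      ← Matrix.mulVec_add, hz, Matrix.mulVec_mulVec, hL.mul_inv t ht, Matrix.one_mulVec]
  · simp [Matrix.fromBlocks_multiply, hE t ht]
  · have h0 : dMat I (fun _ => (0 : Matrix ι ρ ℝ)) t = 0 := dMat_const 0 t
    have h0' : dMat I (fun _ => (0 : Matrix ρ κ ℝ)) t = 0 := dMat_const 0 t
    have h1 : dMat I (fun _ => (1 : Matrix ρ ρ ℝ)) t = 0 := dMat_const 1 t
    rw [dMat_fromBlocks, h0, h0', h1]
    simp [Matrix.fromBlocks_multiply, Matrix.fromBlocks_add, hF t ht]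

/-- Column operations on the border of a bordered pair. -/
theorem pairEquivGen_bordered (hU : UniqueDiffOn ℝ I) (A G : Matrix κ κ ℝ)
    {B X : ℝ → Matrix κ ρ ℝ} {Q Q' : ℝ → Matrix ρ ρ ℝ} (hB : SmoothMat I B) (hX : SmoothMat I X)
    (hQ : SmoothInverse I Q Q') :
    PairEquivGen I (fun t => Matrix.fromBlocks A (B t) 0 0) (fun _ => Matrix.fromBlocks G 0 0 1)
      (fun t => Matrix.fromBlocks A (A * X t + B t * Q t) 0 0)
      (fun _ => Matrix.fromBlocks G 0 0 1) := by
  -- R is the upper right block that the column operation creates in the second matrix; it is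
  -- cleared by rows in which the first matrix vanishes.
  set R : ℝ → Matrix κ ρ ℝ := fun t => G * X t + A * dMat I X t + B t * dMat I Q t with hR
  have hRs : SmoothMat I R := (((SmoothMat.const G).mul hX).add
    ((SmoothMat.const A).mul (hX.derivative hU))).add (hB.mul (hQ.smooth.derivative hU))
  have step1 : PairEquivGen I (fun t => Matrix.fromBlocks A (B t) 0 0)
      (fun _ => Matrix.fromBlocks G 0 0 1)
      (fun t => Matrix.fromBlocks A (A * X t + B t * Q t) 0 0)
      (fun t => Matrix.fromBlocks G (R t) 0 (Q t)) := by
    refine ⟨_, _, _, _, .one, SmoothInverse.upperTriangular .one hQ hX, fun t ht => ?_,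
      fun t ht => ?_⟩
    · simp [Matrix.fromBlocks_multiply]
    · have h0 : dMat I (fun _ => (0 : Matrix ρ κ ℝ)) t = 0 := dMat_const 0 t
      have h1 : dMat I (fun _ => (1 : Matrix κ κ ℝ)) t = 0 := dMat_const 1 t
      rw [dMat_fromBlocks, h0, h1]
      simp [Matrix.fromBlocks_multiply, Matrix.fromBlocks_add, hR, add_assoc]
  refine (step1.trans hU (PairEquivGen.mul_left (SmoothInverse.upperTriangular .one hQ.symm
    (hRs.mul hQ.smooth').neg))).trans hU (PairEquivGen.of_eq (fun t ht => ?_) fun t ht => ?_)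
  · simp [Matrix.fromBlocks_multiply]
  · simp [Matrix.fromBlocks_multiply, Matrix.mul_assoc, hQ.inv_mul t ht]

/-- A smooth matrix function with full row rank can be brought to the form `[1 0]`. -/
theorem exists_rowNormalizer (hI : I.OrdConnected) (hne : I.Nonempty) {q p : ℕ} {B : MatFun q p}
    (hB : SmoothMat I B) (hs : ∀ t ∈ I, Function.Surjective (B t).mulVec) :
    q ≤ p ∧ ∃ Q Q' : MatFun p p, SmoothInverse I Q Q' ∧ ∀ t ∈ I, ∀ x y,
      (B t * Q t) x y = if (x : ℕ) = (y : ℕ) then 1 else 0 := by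
  have hli : ∀ t ∈ I, LinearIndependent ℝ (B t)ᵀ.col := fun t ht => by
    obtain ⟨R, hR⟩ := Matrix.mulVec_surjective_iff_exists_right_inverse.1 (hs t ht)
    rw [← Matrix.mulVec_injective_iff]
    refine Function.LeftInverse.injective (g := Rᵀ.mulVec) fun z => ?_
    rw [Matrix.mulVec_mulVec, ← Matrix.transpose_mul, hR, Matrix.transpose_one, Matrix.one_mulVec]
  have hqp : q ≤ p := by
    obtain ⟨t, ht⟩ := hne
    simpa using (hli t ht).fintype_card_le_finrank
  -- B consists of the first q rows of Tᵀ, so Q = (Tᵀ)⁻¹ turns it into the first q rows of the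
  -- identity.
  obtain ⟨T, hT, hu, hTB⟩ := exists_completion hI hqp hB.transpose hli
  have hQ := SmoothInverse.of_isUnit hT.transpose fun t ht => Matrix.isUnit_transpose _ |>.2 (hu t ht)
  refine ⟨hqp, _, _, hQ.symm, fun t ht x y => ?_⟩
  have h1 : (B t * (T t)ᵀ⁻¹) x y = ((T t)ᵀ * (T t)ᵀ⁻¹) (Fin.castLE hqp x) y := by
    rw [Matrix.mul_apply, Matrix.mul_apply]
    refine Finset.sum_congr rfl fun k _ => ?_
    rw [Matrix.transpose_apply, hTB, Matrix.transpose_apply]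
  rw [h1, hQ.mul_inv t ht, Matrix.one_apply]
  simp [Fin.ext_iff]

end Reduction

/-! ### Construction of the elementary form from a regular pair. -/

section Elementary

variable {I : Set ℝ}

/-- For increasing sizes each block [I 0] has orthonormal rows; only the rows of the last block
vanish. Thus Nᵀ is a right inverse of N away from the last block row, which is what clears the
border. -/
lemma elemNilpotent_mul_transpose {k : ℕ} {ℓ : Fin k → ℕ} (hℓ : Monotone ℓ) :
    elemNilpotent ℓ * (elemNilpotent ℓ)ᵀ =
      Matrix.diagonal fun s => if (s.1 : ℕ) + 1 = k then 0 else 1 := by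
  ext s s'
  rw [Matrix.mul_apply]
  simp only [Matrix.transpose_apply]
  by_cases hs : (s.1 : ℕ) + 1 = k
  · rw [Finset.sum_eq_zero, Matrix.diagonal_apply]
    · simp [hs]
    · intro q _
      have : ¬ ((s.1 : ℕ) + 1 = (q.1 : ℕ)) := by have := q.1.2; omega
      simp [elemNilpotent, this]
  · have hlt : (s.1 : ℕ) + 1 < k := by have := s.1.2; omega
    have hle : ℓ s.1 ≤ ℓ ⟨s.1 + 1, hlt⟩ := hℓ (by simp [Fin.le_def])
    let q₀ : Σ i : Fin k, Fin (ℓ i) := ⟨⟨s.1 + 1, hlt⟩, ⟨s.2, s.2.2.trans_le hle⟩⟩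
    rw [Finset.sum_eq_single q₀]
    · have hss : s = s' ↔ (s.1 : ℕ) = s'.1 ∧ (s.2 : ℕ) = s'.2 := by
        constructor
        · rintro rfl; simp
        · obtain ⟨i, x⟩ := s; obtain ⟨j, y⟩ := s'
          rintro ⟨h1, h2⟩
          obtain rfl := Fin.ext h1
          obtain rfl := Fin.ext h2
          rfl
      simp only [elemNilpotent, Matrix.of_apply, Matrix.diagonal_apply, hss, if_neg hs, q₀]
      have : ((s'.1 : ℕ) + 1 = s.1 + 1 ∧ (s'.2 : ℕ) = s.2) ↔
          ((s.1 : ℕ) = s'.1 ∧ (s.2 : ℕ) = s'.2) := by omega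
      simp only [and_self, if_true, one_mul]
      exact if_congr this rfl rfl
    · rintro ⟨j, y⟩ _ hne
      have : ¬ ((s.1 : ℕ) + 1 = (j : ℕ) ∧ (s.2 : ℕ) = (y : ℕ)) := by
        rintro ⟨h1, h2⟩
        apply hne
        obtain rfl : (⟨s.1 + 1, hlt⟩ : Fin k) = j := Fin.ext h1
        exact congrArg (Sigma.mk _) (Fin.ext h2.symm)
      simp [elemNilpotent, this]
    · simp

/-- The border that appends a last block of size `p` to an elementary nilpotent matrix. -/
def elemBorder (d : ℕ) {k : ℕ} (ℓ : Fin k → ℕ) (p : ℕ) :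
    Matrix (Fin d ⊕ (Σ i : Fin k, Fin (ℓ i))) (Fin p) ℝ :=
  Matrix.of (Sum.elim (fun _ _ => 0)
    fun s y => if (s.1 : ℕ) + 1 = k ∧ (s.2 : ℕ) = (y : ℕ) then 1 else 0)

/-- The last block row of N is zero, so surjectivity of the bordered matrix must come from B in
these rows. This bounds the last block size by p and allows the normalization to [I 0]. -/
theorem exists_border_normalizer (hI : I.OrdConnected) (hne : I.Nonempty) {d k p : ℕ}
    {ℓ : Fin k → ℕ} {B : ℝ → Matrix (Fin d ⊕ (Σ i : Fin k, Fin (ℓ i))) (Fin p) ℝ}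
    (hB : SmoothMat I B)
    (hs : ∀ t ∈ I, Function.Surjective
      (Matrix.fromCols (Matrix.fromBlocks (1 : Matrix (Fin d) (Fin d) ℝ) 0 0 (elemNilpotent ℓ))
        (B t)).mulVec) :
    (∀ i : Fin k, (i : ℕ) + 1 = k → ℓ i ≤ p) ∧ ∃ Q Q' : MatFun p p, SmoothInverse I Q Q' ∧
      ∀ t ∈ I, ∀ s : (Σ i : Fin k, Fin (ℓ i)), (s.1 : ℕ) + 1 = k → ∀ y,
        (B t * Q t) (Sum.inr s) y = if (s.2 : ℕ) = (y : ℕ) then 1 else 0 := by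
  cases k with
  | zero => exact ⟨fun i => i.elim0, _, _, .one, fun t ht s => s.1.elim0⟩
  | succ k =>
    obtain ⟨hp, Q, Q', hQ, hBQ⟩ := exists_rowNormalizer hI hne
      (B := fun t => (B t).submatrix (fun x => Sum.inr ⟨Fin.last k, x⟩) id) (hB.submatrix _ _)
      fun t ht w => by
        obtain ⟨z, hz⟩ := hs t ht (Sum.elim 0 fun s => if h : s.1 = Fin.last k then
          w (h ▸ s.2) else 0)
        refine ⟨z ∘ Sum.inr, funext fun x => ?_⟩
        have h1 := congrFun hz (Sum.inr ⟨Fin.last k, x⟩)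
        rw [Matrix.fromCols_mulVec, Pi.add_apply] at h1
        have h2 : (Matrix.fromBlocks (1 : Matrix (Fin d) (Fin d) ℝ) 0 0 (elemNilpotent ℓ) *ᵥ
            (z ∘ Sum.inl)) (Sum.inr ⟨Fin.last k, x⟩) = 0 := by
          refine Finset.sum_eq_zero fun q _ => ?_
          rcases q with q | q
          · simp
          · have : ¬ (k + 1 = (q.1 : ℕ)) := by have := q.1.2; omega
            simp [elemNilpotent, this]
        rw [h2, zero_add] at h1
        change (B t *ᵥ (z ∘ Sum.inr)) (Sum.inr ⟨Fin.last k, x⟩) = w x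
        simpa using h1
    have hlast : ∀ i : Fin (k + 1), (i : ℕ) + 1 = k + 1 → i = Fin.last k := fun i hi =>
      Fin.ext (by simpa using hi)
    refine ⟨fun i hi => by rw [hlast i hi]; exact hp, Q, Q', hQ, ?_⟩
    rintro t ht ⟨i, x⟩ hi y
    obtain rfl := hlast i hi
    exact hBQ t ht x y

/-- The index set of a family of blocks, with the last block split off. -/
noncomputable def sigmaSnocEquiv {k : ℕ} (ℓ : Fin (k + 1) → ℕ) :
    (Σ i : Fin k, Fin (ℓ i.castSucc)) ⊕ Fin (ℓ (Fin.last k)) ≃ Σ i : Fin (k + 1), Fin (ℓ i) :=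
  Equiv.ofBijective (Sum.elim (fun s => ⟨s.1.castSucc, s.2⟩) fun x => ⟨Fin.last k, x⟩) <| by
    constructor
    · rintro (⟨i, x⟩ | x) (⟨j, y⟩ | y) h
      · simp only [Sum.elim_inl, Sigma.mk.injEq] at h
        obtain ⟨h1, h2⟩ := h
        obtain rfl := Fin.castSucc_injective _ h1
        rw [eq_of_heq h2]
      · exact absurd (congrArg Sigma.fst h) (Fin.castSucc_ne_last i)
      · exact absurd (congrArg Sigma.fst h).symm (Fin.castSucc_ne_last j)
      · simpa using h
    · rintro ⟨i, x⟩
      induction i using Fin.lastCases with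
      | last => exact ⟨Sum.inr x, rfl⟩
      | cast i => exact ⟨Sum.inl ⟨i, x⟩, rfl⟩

@[simp] lemma sigmaSnocEquiv_inl {k : ℕ} (ℓ : Fin (k + 1) → ℕ)
    (s : Σ i : Fin k, Fin (ℓ i.castSucc)) :
    sigmaSnocEquiv ℓ (Sum.inl s) = ⟨s.1.castSucc, s.2⟩ := rfl

@[simp] lemma sigmaSnocEquiv_inr {k : ℕ} (ℓ : Fin (k + 1) → ℕ) (x : Fin (ℓ (Fin.last k))) :
    sigmaSnocEquiv ℓ (Sum.inr x) = ⟨Fin.last k, x⟩ := rfl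

/-- A mere regrouping of indices: the border is the block from the old last block to the new one. -/
theorem pairEquivGen_elemBorder (hU : UniqueDiffOn ℝ I) (d : ℕ) {k : ℕ} (ℓ : Fin (k + 1) → ℕ)
    (α : ℝ) :
    PairEquivGen I
      (fun _ => Matrix.fromBlocks
        (Matrix.fromBlocks (1 : Matrix (Fin d) (Fin d) ℝ) 0 0
          (elemNilpotent fun i : Fin k => ℓ i.castSucc))
        (elemBorder d (fun i : Fin k => ℓ i.castSucc) (ℓ (Fin.last k))) 0 0)
      (fun _ => Matrix.fromBlocks
        (Matrix.fromBlocks (α • 1 : Matrix (Fin d) (Fin d) ℝ) 0 0 1) 0 0 1)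
      (fun _ => Matrix.fromBlocks (1 : Matrix (Fin d) (Fin d) ℝ) 0 0 (elemNilpotent ℓ))
      (fun _ => Matrix.fromBlocks (α • 1 : Matrix (Fin d) (Fin d) ℝ) 0 0 1) := by
  let e := (Equiv.sumAssoc (Fin d) (Σ i : Fin k, Fin (ℓ i.castSucc)) (Fin (ℓ (Fin.last k)))).trans
    (Equiv.sumCongr (Equiv.refl _) (sigmaSnocEquiv ℓ))
  refine PairEquivGen.symm hU ((PairEquivGen.submatrix e.symm).trans hU
    (PairEquivGen.of_eq (fun t _ => ?_) fun t _ => ?_))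
  · ext ((i | s) | x) ((j | s') | y)
    · simp [e, Matrix.one_apply]
    · simp [e]
    · simp [e, elemBorder]
    · simp [e]
    · simp [e, elemNilpotent]
    · simp [e, elemNilpotent, elemBorder]
    · simp [e]
    · have : ¬ (k + 1 = (s'.1 : ℕ)) := by have := s'.1.2; omega
      simp [e, elemNilpotent, this]
    · simp [e, elemNilpotent]
  · have h1 : (1 : Matrix (Σ i : Fin (k + 1), Fin (ℓ i)) (Σ i : Fin (k + 1), Fin (ℓ i)) ℝ).submatrix
        (sigmaSnocEquiv ℓ) (sigmaSnocEquiv ℓ) = 1 := Matrix.submatrix_one_equiv _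
    rw [← Matrix.fromBlocks_one] at h1
    have h2 : ∀ a b, (1 : Matrix (Σ i : Fin (k + 1), Fin (ℓ i)) (Σ i : Fin (k + 1), Fin (ℓ i)) ℝ)
        (sigmaSnocEquiv ℓ a) (sigmaSnocEquiv ℓ b) = Matrix.fromBlocks 1 0 0 1 a b := fun a b =>
      (congrFun (congrFun h1 a) b)
    ext ((i | s) | x) ((j | s') | y)
    · simp [e, Matrix.one_apply]
    · simp [e]
    · simp [e]
    · simp [e]
    · exact (h2 (Sum.inl s) (Sum.inl s')).symm
    · exact (h2 (Sum.inl s) (Sum.inr y)).symm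
    · simp [e]
    · exact (h2 (Sum.inr x) (Sum.inl s')).symm
    · exact (h2 (Sum.inr x) (Sum.inr y)).symm

/-- A bordered elementary pair with full row rank is equivalent to an elementary pair with one
more block. -/
theorem exists_elementary_of_bordered (hI : I.OrdConnected) (hI' : I.Nontrivial) {d k p : ℕ}
    (hp : 0 < p) {ℓ : Fin k → ℕ} (hpos : ∀ i, 0 < ℓ i) (hℓ : Monotone ℓ) (α : ℝ)
    {B : ℝ → Matrix (Fin d ⊕ (Σ i : Fin k, Fin (ℓ i))) (Fin p) ℝ} (hB : SmoothMat I B)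
    (hs : ∀ t ∈ I, Function.Surjective
      (Matrix.fromCols (Matrix.fromBlocks (1 : Matrix (Fin d) (Fin d) ℝ) 0 0 (elemNilpotent ℓ))
        (B t)).mulVec) :
    ∃ ℓ' : Fin (k + 1) → ℕ, (∀ i, 0 < ℓ' i) ∧ Monotone ℓ' ∧
      PairEquivGen I
        (fun t => Matrix.fromBlocks (Matrix.fromBlocks 1 0 0 (elemNilpotent ℓ)) (B t) 0 0)
        (fun _ => Matrix.fromBlocks
          (Matrix.fromBlocks (α • 1 : Matrix (Fin d) (Fin d) ℝ) 0 0 1) 0 0 1)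
        (fun _ => Matrix.fromBlocks (1 : Matrix (Fin d) (Fin d) ℝ) 0 0 (elemNilpotent ℓ'))
        (fun _ => Matrix.fromBlocks (α • 1 : Matrix (Fin d) (Fin d) ℝ) 0 0 1) := by
  have hU := interval_uniqueDiffOn hI hI'
  obtain ⟨hlast, Q, Q', hQ, hBQ⟩ := exists_border_normalizer hI hI'.nonempty hB hs
  set A : Matrix (Fin d ⊕ (Σ i : Fin k, Fin (ℓ i))) (Fin d ⊕ (Σ i : Fin k, Fin (ℓ i))) ℝ :=
    Matrix.fromBlocks 1 0 0 (elemNilpotent ℓ) with hA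
  have hAA : A * Aᵀ = Matrix.diagonal
      (Sum.elim (fun _ => 1) fun s => if (s.1 : ℕ) + 1 = k then 0 else 1) := by
    rw [hA, Matrix.fromBlocks_transpose, Matrix.fromBlocks_multiply,
      ← Matrix.fromBlocks_diagonal, ← elemNilpotent_mul_transpose hℓ]
    simp
  -- A Aᵀ projects onto the rows outside the last block, and in the last block BQ already has the
  -- desired form; hence X = Aᵀ(border - BQ) corrects all the rest.
  have key : ∀ t ∈ I, A * (Aᵀ * (elemBorder d ℓ p - B t * Q t)) + B t * Q t =
      elemBorder d ℓ p := fun t ht => by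
    rw [← Matrix.mul_assoc, hAA]
    ext (i | s) y
    · rw [Matrix.add_apply, Matrix.diagonal_mul]; simp
    · rw [Matrix.add_apply, Matrix.diagonal_mul]
      by_cases h : (s.1 : ℕ) + 1 = k
      · simp [h, hBQ t ht s h, elemBorder]
      · simp [h]
  have hX : SmoothMat I fun t => Aᵀ * (elemBorder d ℓ p - B t * Q t) :=
    (SmoothMat.const _).mul ((SmoothMat.const _).sub (hB.mul hQ.smooth))
  have h1 := (pairEquivGen_bordered hU A (Matrix.fromBlocks (α • 1) 0 0 1) hB hX hQ).trans hU
    (PairEquivGen.of_eq (G := fun _ => Matrix.fromBlocks A (elemBorder d ℓ p) 0 0)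
      (fun t ht => by rw [key t ht]) fun t _ => rfl)
  clear_value A
  -- Substituting ℓ and p by the parts of one family ℓ' avoids casts between index types.
  obtain ⟨ℓ', hℓ', hp'⟩ : ∃ ℓ' : Fin (k + 1) → ℕ, (fun i => ℓ' i.castSucc) = ℓ ∧
      ℓ' (Fin.last k) = p := ⟨Fin.snoc (α := fun _ => ℕ) ℓ p, by simp, by simp⟩
  subst hℓ' hp' hA
  refine ⟨ℓ', fun i => ?_, ?_, h1.trans hU (pairEquivGen_elemBorder hU d ℓ' α)⟩
  · induction i using Fin.lastCases with
    | last => exact hp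
    | cast i => exact hpos i
  · refine Fin.monotone_iff_le_succ.2 fun i => ?_
    by_cases h : (i : ℕ) + 1 = k
    · have : i.succ = Fin.last k := Fin.ext (by simpa using h)
      rw [this]
      exact hlast i h
    · have hlt : (i : ℕ) + 1 < k := by have := i.2; omega
      exact hℓ (show i ≤ ⟨i + 1, hlt⟩ by simp [Fin.le_def])

/-- K solves dK/dt = (α - E⁻¹F)K and L = K⁻¹E⁻¹; then LFK + K⁻¹ dK/dt = α. -/
theorem pairEquivGen_of_isUnit (hI : I.OrdConnected) (hI' : I.Nontrivial) {m : ℕ}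
    {E F : MatFun m m} (hE : SmoothMat I E) (hF : SmoothMat I F) (hu : ∀ t ∈ I, IsUnit (E t))
    (α : ℝ) : PairEquivGen I E F (fun _ => 1) (fun _ => α • (1 : Matrix (Fin m) (Fin m) ℝ)) := by
  have hEi := SmoothInverse.of_isUnit hE hu
  obtain ⟨K, hK, hKu, hd⟩ := exists_smooth_fundamentalMatrix hI hI'
    (A := fun t => α • 1 - (E t)⁻¹ * F t) ((SmoothMat.const _).sub (hEi.smooth'.mul hF))
  have hKi := SmoothInverse.of_isUnit hK hKu
  refine ⟨_, _, _, _, hKi.symm.mul hEi.symm, hKi, fun t ht => ?_, fun t ht => ?_⟩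
  · rw [Matrix.mul_assoc (K t)⁻¹, hEi.inv_mul t ht, Matrix.mul_one, hKi.inv_mul t ht]
  · rw [hd t ht, Matrix.mul_assoc (K t)⁻¹ _ (E t), hEi.inv_mul t ht, Matrix.sub_mul,
      Matrix.mul_one, Matrix.mul_sub, Matrix.smul_mul, Matrix.one_mul, Matrix.mul_smul,
      hKi.inv_mul t ht]
    simp only [Matrix.mul_assoc]
    abel

/-- Every regular pair is equivalent to an elementary one with increasing block sizes. -/
theorem exists_elementary_of_isRegularOfIndex (hI : I.OrdConnected) (hI' : I.Nontrivial) (α : ℝ)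
    {μ m : ℕ} {E F : MatFun m m} (hE : SmoothMat I E) (hF : SmoothMat I F)
    (h : IsRegularOfIndex I μ E F) :
    ∃ (d k : ℕ) (ℓ : Fin k → ℕ), (∀ i, 0 < ℓ i) ∧ Monotone ℓ ∧
      PairEquivGen I E F
        (fun _ => Matrix.fromBlocks (1 : Matrix (Fin d) (Fin d) ℝ) 0 0 (elemNilpotent ℓ))
        (fun _ => Matrix.fromBlocks (α • 1 : Matrix (Fin d) (Fin d) ℝ) 0 0 1) := by
  have hU := interval_uniqueDiffOn hI hI'
  induction μ generalizing m with
  | zero =>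
    refine ⟨m, 0, Fin.elim0, fun i => i.elim0, fun i => i.elim0,
      (pairEquivGen_of_isUnit hI hI' hE hF h α).trans hU
        ((PairEquivGen.submatrix (Equiv.sumEmpty (Fin m) _).symm).trans hU
          (PairEquivGen.of_eq (fun t _ => ?_) fun t _ => ?_))⟩
    · ext (i | s) (j | s')
      · rfl
      · exact s'.1.elim0
      · exact s.1.elim0
      · exact s.1.elim0
    · ext (i | s) (j | s')
      · rfl
      · exact s'.1.elim0
      · exact s.1.elim0
      · exact s.1.elim0
  | succ μ ih =>
    obtain ⟨r, θ, hrm, hpre, Y, C, hY, hC, hred⟩ := h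
    have hYs := hY.smoothMat
    have hCs := hC.smoothMat
    -- The border width m - r, positive since r < m, becomes the size of the new last block.
    obtain ⟨B, hB, hsurj, hbord⟩ := exists_bordered_form hI hU (p := m - r) (by omega) hE hF
      hpre.im_sup_im hY hC
    obtain ⟨d, k, ℓ, hpos, hℓ, heq⟩ := ih ((hYs.transpose.mul hE).mul hCs)
      (((hYs.transpose.mul hF).mul hCs).add ((hYs.transpose.mul hE).mul (hCs.derivative hU))) hred
    obtain ⟨B', hB', hsurj', htrans⟩ := exists_bordered_transfer heq hB hsurj
    obtain ⟨ℓ', hpos', hℓ', hel⟩ := exists_elementary_of_bordered hI hI' (by omega) hpos hℓ α hB'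
      hsurj'
    exact ⟨d, k + 1, ℓ', hpos', hℓ', (hbord.trans hU htrans).trans hU hel⟩

/-- By monotonicity the indices j with ℓ j ≤ x form an initial segment, which its cardinality
determines. -/
lemma Monotone.le_iff_lt_card {k : ℕ} {ℓ : Fin k → ℕ} (hℓ : Monotone ℓ) (i : Fin k) (x : ℕ) :
    ℓ i ≤ x ↔ (i : ℕ) < (Finset.univ.filter fun j => ℓ j ≤ x).card := by
  constructor
  · intro h
    have h1 : Finset.Iic i ⊆ Finset.univ.filter fun j => ℓ j ≤ x := fun j hj => by
      simpa using (hℓ (Finset.mem_Iic.1 hj)).trans h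
    have h2 := Finset.card_le_card h1
    rw [Fin.card_Iic] at h2
    omega
  · contrapose!
    intro h
    have h1 : (Finset.univ.filter fun j => ℓ j ≤ x) ⊆ Finset.Iio i := fun j hj => by
      rw [Finset.mem_Iio]
      by_contra hji
      have := hℓ (not_lt.1 hji)
      have := (Finset.mem_filter.1 hj).2
      omega
    have h2 := Finset.card_le_card h1
    rwa [Fin.card_Iio] at h2

/-- Reversing the order of increasing block sizes permutes the elementary nilpotent matrix. -/
theorem exists_reverse_equiv {k : ℕ} {ℓ : Fin k → ℕ} (hℓ : Monotone ℓ) :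
    ∃ e : (Σ i : Fin k, Fin (ℓ i)) ≃ (Σ i : Fin k, Fin (ℓ i.rev)),
      (elemNilpotent fun i => ℓ i.rev).submatrix e e = elemNilpotent ℓ := by
  -- c x is the first block with a position x. The ones of N link position x along the blocks c x,
  -- …, k - 1; the map f shifts this chain to start at block 0, keeping x.
  set c : ℕ → ℕ := fun x => (Finset.univ.filter fun j => ℓ j ≤ x).card with hc
  have hmem : ∀ s : (Σ i : Fin k, Fin (ℓ i)), c s.2 ≤ s.1 := fun s => by
    have h1 := hℓ.le_iff_lt_card s.1 s.2
    have h2 := s.2.2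
    simp only [hc]
    omega
  have hlt : ∀ s : (Σ i : Fin k, Fin (ℓ i)), (s.1 : ℕ) - c s.2 < k := fun s => by
    have := s.1.2; omega
  have hlt' : ∀ s : (Σ i : Fin k, Fin (ℓ i)),
      (s.2 : ℕ) < ℓ (Fin.rev ⟨(s.1 : ℕ) - c s.2, hlt s⟩) := fun s => by
    -- The reversed index k - 1 - (i - c x) is at least c x because i < k, so the target block has a
    -- position x.
    have h1 : _ ↔ ((Fin.rev ⟨(s.1 : ℕ) - c s.2, hlt s⟩ : Fin k) : ℕ) < c s.2 :=
      hℓ.le_iff_lt_card _ s.2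
    rw [Fin.val_rev] at h1
    have h2 := hmem s
    have h3 := s.1.2
    by_contra hcon
    have h4 := h1.1 (not_lt.1 hcon)
    simp only at h4
    omega
  let f : (Σ i : Fin k, Fin (ℓ i)) → (Σ i : Fin k, Fin (ℓ i.rev)) := fun s =>
    ⟨⟨(s.1 : ℕ) - c s.2, hlt s⟩, ⟨s.2, hlt' s⟩⟩
  have hval : ∀ s s' : (Σ i : Fin k, Fin (ℓ i.rev)), s = s' →
      (s.1 : ℕ) = s'.1 ∧ (s.2 : ℕ) = s'.2 := by rintro s _ rfl; simp
  have hf : Function.Bijective f := by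
    rw [Fintype.bijective_iff_injective_and_card]
    constructor
    · rintro ⟨i, x⟩ ⟨j, y⟩ h
      obtain ⟨h1, h2⟩ := hval _ _ h
      have h3 := hmem ⟨i, x⟩
      have h4 := hmem ⟨j, y⟩
      simp only [f] at h1 h2 h3 h4
      rw [h2] at h1 h3
      obtain rfl : i = j := Fin.ext (by omega)
      obtain rfl := Fin.ext h2
      rfl
    · simp only [Fintype.card_sigma, Fintype.card_fin]
      exact (Equiv.sum_comp Fin.revPerm ℓ).symm
  refine ⟨Equiv.ofBijective f hf, ?_⟩
  ext s s'
  simp only [Matrix.submatrix_apply, Equiv.ofBijective_apply, elemNilpotent, Matrix.of_apply, f]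
  refine if_congr ?_ rfl rfl
  refine and_congr_left fun h => ?_
  have h3 := hmem s
  have h4 := hmem s'
  rw [h] at h3 ⊢
  omega

theorem PairEquivGen.equivToElementary {m d k : ℕ} {ℓ : Fin k → ℕ} {E F : MatFun m m} {α : ℝ}
    (hI : I.Nonempty) (hU : UniqueDiffOn ℝ I) {P : ∀ {μ : ℕ}, (Fin μ → ℕ) → Prop}
    (hpos : ∀ i, 0 < ℓ i) (hP : P ℓ)
    (h : PairEquivGen I E F
      (fun _ => Matrix.fromBlocks (1 : Matrix (Fin d) (Fin d) ℝ) 0 0 (elemNilpotent ℓ))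
      (fun _ => Matrix.fromBlocks (α • 1 : Matrix (Fin d) (Fin d) ℝ) 0 0 1)) :
    EquivToElementary I E F α P := by
  -- The invertible matrix L at one point of `I` forces both sizes to agree.
  have hm : d + ∑ i, ℓ i = m := by
    obtain ⟨L, L', -, -, hL, -⟩ := h
    obtain ⟨t, ht⟩ := hI
    simpa using (Matrix.toLin'OfInv (hL.mul_inv t ht) (hL.inv_mul t ht)).finrank_eq
  exact ⟨d, k, ℓ, hm, hpos, hP,
    PairEquivGen.pairEquiv_iff.1 (h.trans hU (PairEquivGen.submatrix (blockIndex hm)))⟩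

end Elementary

theorem mainTheorem6 (I : Set ℝ) (hI : I.OrdConnected) (hI' : I.Nontrivial) (m : ℕ)
    (E F : MatFun m m) (hE : E.SmoothOn I) (hF : F.SmoothOn I) (α : ℝ) :
    (IsRegularPair I E F ↔ EquivToElementaryC I E F α) ∧
      (IsRegularPair I E F ↔ EquivToElementaryR I E F α) := by
  have hU := interval_uniqueDiffOn hI hI'
  refine ⟨⟨?_, isRegularPair_of_equivToElementary hU⟩,
    ⟨?_, isRegularPair_of_equivToElementary hU⟩⟩
  · rintro ⟨μ, hμ⟩
    obtain ⟨d, k, ℓ, hpos, hℓ, heq⟩ := exists_elementary_of_isRegularOfIndex hI hI' α hE hF hμ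
    obtain ⟨e, he⟩ := exists_reverse_equiv hℓ
    refine PairEquivGen.equivToElementary hI'.nonempty hU (ℓ := fun i => ℓ i.rev) (d := d)
      (fun i => hpos _) (fun i j hij => hℓ (Fin.rev_le_rev.2 hij)) (heq.trans hU ?_)
    refine PairEquivGen.symm hU ((PairEquivGen.submatrix
      (Equiv.sumCongr (Equiv.refl _) e).symm).trans hU
      (PairEquivGen.of_eq (fun t _ => ?_) fun t _ => ?_))
    · rw [← he]
      ext (i | s) (j | s') <;> simp [Matrix.one_apply]
    · ext (i | s) (j | s') <;> simp [Matrix.one_apply]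
  · rintro ⟨μ, hμ⟩
    obtain ⟨d, k, ℓ, hpos, hℓ, heq⟩ := exists_elementary_of_isRegularOfIndex hI hI' α hE hF hμ
    exact heq.equivToElementary hI'.nonempty hU hpos hℓ
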